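/- Let $(e_0,e_1,e_2)$ be the standard basis of $\mathbb C^3$, $\omega=e^{2\pi i/3}$, and let $X e_k=e_{(k+1)\bmod 3}$, $Z e_k=\omega^k e_k$ generate the Heisenberg–Weyl (HW) group. A unit vector $\psi\in\mathbb C^3$ is called an HW fiducial state if $|\langle\psi|X^{k_1}Z^{k_2}|\psi\rangle|=\tfrac12$ for all $(k_1,k_2)\ne(0,0)$ modulo $3$; the nine vectors $\psi_{k_1k_2}=X^{k_1}Z^{k_2}\psi$, $0\le k_1,k_2\le 2$, then form the HW-covariant SIC POVM generated from $\psi$ (a SIC POVM in dimension $d$ being given by $d^2$ vectors with $|\langle\psi_j|\psi_k\rangle|^2=(1+d\delta_{jk})/(d+1)$). Two SIC POVMs are equivalent if a unitary or antiunitary operator maps the rank-one projectors of one bijectively onto those of the other. Let $A$ be the $9\times 9$ Gram matrix of the vectors $\psi_{k_1k_2}$ and let $$|\Psi(\psi)\rangle=\sqrt{9!/\operatorname{perm}(A)}\;P_{\rm sym}\bigotimes_{k_1,k_2}|\psi_{k_1k_2}\rangle\in(\mathbb C^3)^{\otimes 9},$$ where $P_{\rm sym}$ is the projector onto the symmetric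 subspace. The geometric measure of entanglement of a multipartite pure state is $G(|\Psi\rangle)=-2\log_2\Lambda(|\Psi\rangle)$, where $\Lambda^2(|\Psi\rangle)$ is the maximum of $|\langle\Phi|\Psi\rangle|^2$ over all pure product states $|\Phi\rangle$ of unit vectors. For $t\in\mathbb R$ put $\psi(t)=(e_1-e^{it}e_2)/\sqrt2$ and let $A(t)$ be the corresponding Gram matrix. (1) For every real $t$, $\psi(t)$ is an HW fiducial state, its nine translates form a SIC POVM, $$\operatorname{perm}(A(t))=\tfrac{27}{32}\,[61-\cos(9t)],\qquad G(|\Psi(\psi(t))\rangle)=\log_2\frac{16\,[61-\cos(9t)]}{105}.$$ (2) For every HW fiducial state $\psi\in\mathbb C^3$ there is exactly one $t\in[0,\pi/9]$ such that the SIC POVMs generated from $\psi$ and from $\psi(t)$ are equivalent. (3) For any two HW fiducial states $\psi,\varphi\in\mathbb C^3$, the SIC POVMs generated from $\psi$ and from $\varphi$ are equivalent if and only if $G(|\Psi(\psi)\rangle)=G(|\Psi(\varphi)\rangle)$. -/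

import Mathlib

noncomputable section

namespace SICGM

open scoped InnerProductSpace

/-- The Hilbert space of one `d`-level particle, with computational basis
`e_k = EuclideanSpace.single k 1`. -/
abbrev Ket (d : ℕ) : Type := EuclideanSpace ℂ (Fin d)

/-- The Hilbert space `⨂_{k : ι} ℂ^d` of a family of `d`-level particles labelled by `ι`, in
coordinates with respect to the product basis `⨂_k e_{i k}`, `i : ι → Fin d`. -/
abbrev MultiKet (ι : Type) [Fintype ι] (d : ℕ) : Type := EuclideanSpace ℂ (ι → Fin d)

section Multipartite

variable {ι : Type} [Fintype ι] [DecidableEq ι] {d : ℕ}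

/-- The product ket `⨂_k a_k`. -/
def prodKet (a : ι → Ket d) : MultiKet ι d :=
  WithLp.toLp 2 fun i => ∏ k, a k (i k)

/-- The set of the squared overlaps `|⟨Φ|Ψ⟩|²` of `Ψ` with the pure product states `Φ`. -/
def overlapSet (Ψ : MultiKet ι d) : Set ℝ :=
  {x | ∃ φ : ι → Ket d, (∀ k, ‖φ k‖ = 1) ∧ x = ‖⟪prodKet φ, Ψ⟫_ℂ‖ ^ 2}

/-- `Λ²(Ψ)`: the maximal squared overlap of `Ψ` with a pure product state. The supremum is a
maximum, see `maxOverlapSq_isGreatest`. -/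
def maxOverlapSq (Ψ : MultiKet ι d) : ℝ := sSup (overlapSet Ψ)

/-- The geometric measure of entanglement `G(Ψ) = -2 log₂ Λ(Ψ)`. -/
def geometricMeasure (Ψ : MultiKet ι d) : ℝ :=
  -2 * Real.logb 2 (Real.sqrt (maxOverlapSq Ψ))

theorem maxOverlapSq_isGreatest [NeZero d] (Ψ : MultiKet ι d) :
    IsGreatest (overlapSet Ψ) (maxOverlapSq Ψ) := by
  have hK : IsCompact (Set.pi Set.univ fun _ : ι => Metric.sphere (0 : Ket d) 1) :=
    isCompact_univ_pi fun _ => isCompact_sphere _ _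
  have hc : Continuous fun φ : ι → Ket d => ‖⟪prodKet φ, Ψ⟫_ℂ‖ ^ 2 := by
    have : Continuous fun φ : ι → Ket d => prodKet φ := by
      unfold prodKet
      fun_prop
    fun_prop
  have himg : overlapSet Ψ = (fun φ : ι → Ket d => ‖⟪prodKet φ, Ψ⟫_ℂ‖ ^ 2) ''
      (Set.pi Set.univ fun _ : ι => Metric.sphere (0 : Ket d) 1) := by
    ext x
    simp only [overlapSet, Set.mem_ofPred_eq, Set.mem_image, Set.mem_univ_pi,
      mem_sphere_zero_iff_norm]
    exact ⟨fun ⟨φ, h, e⟩ => ⟨φ, h, e.symm⟩, fun ⟨φ, h, e⟩ => ⟨φ, h, e.symm⟩⟩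
  have hne : (overlapSet Ψ).Nonempty :=
    ⟨_, fun _ => EuclideanSpace.single 0 1, fun _ => by simp, rfl⟩
  unfold maxOverlapSq
  rw [himg] at hne ⊢
  exact (hK.image hc).isGreatest_sSup hne

/-- The projector `P_sym` onto the symmetric subspace: the average of all permutations of the
particles. -/
def symProj (v : MultiKet ι d) : MultiKet ι d :=
  WithLp.toLp 2 fun i =>
    (1 / ((Fintype.card ι).factorial : ℂ)) * ∑ σ : Equiv.Perm ι, v (i ∘ σ)

/-- `P_sym ⨂_k |a_k⟩ = (1 / N!) ∑_σ ⨂_k |a_{σ(k)}⟩`. -/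
theorem symProj_prodKet (a : ι → Ket d) :
    symProj (prodKet a) = (1 / ((Fintype.card ι).factorial : ℂ)) •
      ∑ σ : Equiv.Perm ι, prodKet fun k => a (σ k) := by
  ext i
  simp only [symProj, prodKet, PiLp.smul_apply, WithLp.ofLp_sum, Finset.sum_apply, smul_eq_mul,
    Function.comp_apply]
  congr 1
  refine Fintype.sum_equiv (Equiv.inv (Equiv.Perm ι)) _ _ fun σ => ?_
  exact Fintype.prod_equiv σ _ _ fun k => by simp

/-- The normalized symmetrized state `√(N! / perm A) P_sym ⨂_j |ψ_j⟩`, where `A` is the Gram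
matrix `A_{jk} = ⟨ψ_j|ψ_k⟩`, whose permanent is real. -/
def symState (ψ : ι → Ket d) : MultiKet ι d :=
  ((Real.sqrt ((Fintype.card ι).factorial / (Matrix.gram ℂ ψ).permanent.re) : ℝ) : ℂ) •
    symProj (prodKet ψ)

end Multipartite

/-- The kets `ψ_j` are the normalized outcomes of a SIC POVM in dimension `d`: there are `d²` of
them and `|⟨ψ_j|ψ_k⟩|² = (1 + d δ_{jk}) / (d + 1)`. -/
def IsSIC {ι : Type} [Fintype ι] [DecidableEq ι] {d : ℕ} (ψ : ι → Ket d) : Prop :=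
  Fintype.card ι = d ^ 2 ∧
    ∀ j k, ‖⟪ψ j, ψ k⟫_ℂ‖ ^ 2 = (1 + (d : ℝ) * (if j = k then 1 else 0)) / ((d : ℝ) + 1)

/-- Two families of normalized kets `ψ`, `φ` (in particular, two SIC POVMs) are equivalent if some
unitary or antiunitary operator maps the projectors `|ψ_j⟩⟨ψ_j|` bijectively onto the projectors
`|φ_k⟩⟨φ_k|`, that is, maps the `ψ_j` to the `φ_k` up to relabelling and phase factors. -/
def Equivalent {ι : Type} {d : ℕ} (ψ φ : ι → Ket d) : Prop :=
  ∃ (σ : Equiv.Perm ι) (c : ι → ℂ), (∀ j, ‖c j‖ = 1) ∧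
    ((∃ U : Ket d ≃ₗᵢ[ℂ] Ket d, ∀ j, U (ψ j) = c j • φ (σ j)) ∨
      (∃ U : Ket d ≃ₛₗᵢ[starRingEnd ℂ] Ket d, ∀ j, U (ψ j) = c j • φ (σ j)))

section HeisenbergWeyl

variable {d : ℕ} [NeZero d]

/-- The cyclic shift `X e_k = e_{(k+1) mod d}` (addition in `Fin d` is modulo `d`). -/
def shiftX (d : ℕ) [NeZero d] : Matrix (Fin d) (Fin d) ℂ :=
  Matrix.of fun i j => if i = j + 1 then 1 else 0

/-- The phase operator `Z e_k = ω^k e_k`, `ω = exp(2πi/d)`. -/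
def clockZ (d : ℕ) : Matrix (Fin d) (Fin d) ℂ :=
  Matrix.diagonal fun k => Complex.exp (2 * Real.pi * Complex.I / d) ^ (k : ℕ)

/-- The `d²` kets `X^{k₁} Z^{k₂} |ψ⟩`, `k₁, k₂ = 0, …, d - 1`. -/
def hwOrbit (ψ : Ket d) : Fin d × Fin d → Ket d := fun k =>
  Matrix.toEuclideanLin (shiftX d ^ (k.1 : ℕ) * clockZ d ^ (k.2 : ℕ)) ψ

/-- `ψ` is a (normalized) fiducial state of the Heisenberg–Weyl group:
`|⟨ψ|X^{k₁} Z^{k₂}|ψ⟩| = 1 / √(d + 1)` for all `(k₁, k₂) ≠ (0, 0)` modulo `d`. -/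
def IsFiducial (ψ : Ket d) : Prop :=
  ‖ψ‖ = 1 ∧ ∀ k : Fin d × Fin d, k ≠ (0, 0) →
    ‖⟪ψ, hwOrbit ψ k⟫_ℂ‖ = 1 / Real.sqrt ((d : ℝ) + 1)

end HeisenbergWeyl

/-- The kets `(e_1 - e^{it} e_2) / √2` in dimension three, where the basis is `e_0, e_1, e_2`. -/
def fiducial3 (t : ℝ) : Ket 3 :=
  ((1 / Real.sqrt 2 : ℝ) : ℂ) •
    (EuclideanSpace.single 1 1 - Complex.exp (Complex.I * t) • EuclideanSpace.single 2 1)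

end SICGM

end

/-!
The overlap of the symmetrized state `Ψ(ψ)` with a product state `⨂_k x_k` is, up to normalization,
the permanent of the matrix of the `⟨x_k|ψ_j⟩`, a symmetric multilinear form in the `x_k` up to
conjugation. By Banach's theorem (`norm_apply_le_of_forall_diagonal`) such a form attains its norm on
the diagonal, so `Λ²(Ψ)` is `9! / perm A` times the maximum over unit vectors `v` of the product of the
nine numbers `p_j = |⟨v|ψ_j⟩|²`. For the orbit of `ψ(t)` these numbers have sum `3` and sum of squares
`3 / 2`, since a SIC POVM is a 2-design. Comparing `log p` with the quadratic polynomial that touches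
it at `1 / 4` and meets it at `1` gives `∏ p_j ≤ 4⁻⁸` (`prod_le_of_sum_of_sum_sq`), with equality if
`v` is one of the nine kets. Hence `G = log₂ (4⁸ perm A / 9!)`.

The permanent of a Gram matrix is the sum of `α! |c_α|²` over the coefficients `c_α` of the product
of the linear forms with the coordinates of the kets as coefficients
(`permanent_gram_eq_sum_coeff`). For the orbit of `ψ(t)` and `s = e^{3it}` the nine forms multiply to
`(X_1³ - s X_2³) (X_2³ - s X_0³) (X_0³ - s X_1³)` up to a constant, a polynomial with seven monomials.

For a fiducial state with coordinates `x, y, z`, the overlap conditions say that `|x|, |y|, |z|` are the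
sides of a degenerate triangle and that `x z ȳ² + y x z̄² + z y x̄² = 0`. If a coordinate vanishes, a
cyclic shift and a phase turn the state into some `ψ(t)`. Otherwise the second condition fixes the
phases of the coordinates up to sixth roots of unity; a diagonal operator whose entries are cube roots
of unity makes the state real with coordinates adding up to zero, and the Fourier transform takes it
to a state with a vanishing coordinate. All these unitaries normalize the Heisenberg–Weyl group. The
coordinate reflection changes `t` into `-t`, and `diag (1, ζ, ζ²)` with `ζ⁹ = 1` multiplies `e^{it}` by
`ζ`, so only `cos 9t` matters (`unitarilyEquivalent_fiducial3_of_cos_eq`). Conversely `perm A`, which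
determines both `cos 9t` and `G`, is invariant under unitary and antiunitary equivalence, and so is
`G`.
-/

noncomputable section

namespace SICGM

open scoped InnerProductSpace

section Banach

/-! ### The norm of a symmetric multilinear form is attained on the diagonal -/

/-- Equality in the Cauchy–Schwarz inequality: a linear functional that attains its norm at the
unit vector `y` is a multiple of `⟪y, ·⟫`. -/
theorem apply_eq_mul_inner_of_norm_attained {E : Type*} [NormedAddCommGroup E]
    [InnerProductSpace ℂ E] (g : E →ₗ[ℂ] ℂ) {y : E} (hy : ‖y‖ = 1)
    (hg : ∀ z, ‖g z‖ ≤ ‖g y‖ * ‖z‖) (z : E) : g z = g y * ⟪y, z⟫_ℂ := by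
  -- It suffices that `g` vanishes at `w = z - ⟪y, z⟫ y`, which is orthogonal to `y`.
  set w : E := z - ⟪y, z⟫_ℂ • y with hw
  have hyw : ⟪y, w⟫_ℂ = 0 := by
    simp [hw, inner_self_eq_norm_sq_to_K, hy]
  have hgw : g w = 0 := by
    -- Compare `g v` and `‖v‖` for the vector `v` of the span of `y` and `w` representing `g`.
    have h1 := hg (((‖w‖ : ℂ) ^ 2 * starRingEnd ℂ (g y)) • y + starRingEnd ℂ (g w) • w)
    have h2 : g (((‖w‖ : ℂ) ^ 2 * starRingEnd ℂ (g y)) • y + starRingEnd ℂ (g w) • w)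
        = ((‖w‖ ^ 2 * ‖g y‖ ^ 2 + ‖g w‖ ^ 2 : ℝ) : ℂ) := by
      rw [map_add, map_smul, map_smul, smul_eq_mul, smul_eq_mul, mul_assoc, Complex.conj_mul',
        Complex.conj_mul']
      push_cast
      rfl
    have h3 : ‖((‖w‖ : ℂ) ^ 2 * starRingEnd ℂ (g y)) • y + starRingEnd ℂ (g w) • w‖ ^ 2
        = ‖w‖ ^ 4 * ‖g y‖ ^ 2 + ‖g w‖ ^ 2 * ‖w‖ ^ 2 := by
      rw [@norm_add_sq ℂ, inner_smul_left, inner_smul_right, hyw, norm_smul, norm_smul, hy]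
      simp [mul_pow, ← pow_mul]
    rw [h2, Complex.norm_real, Real.norm_of_nonneg (by positivity)] at h1
    have h4 := pow_le_pow_left₀ (by positivity) h1 2
    rw [mul_pow, h3] at h4
    have h5 : (‖g w‖ ^ 2) ^ 2 ≤ 0 := by
      nlinarith [mul_nonneg (sq_nonneg (‖w‖ * ‖g y‖)) (sq_nonneg ‖g w‖)]
    simpa using h5.antisymm (by positivity)
  have hz : z = w + ⟪y, z⟫_ℂ • y := by rw [hw]; abel
  conv_lhs => rw [hz, map_add, hgw, map_smul, smul_eq_mul, zero_add, mul_comm]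

variable {ι : Type*} [DecidableEq ι] {E : Type*} [NormedAddCommGroup E] [InnerProductSpace ℂ E]

/-- If a symmetric multilinear form attains its norm at the unit vectors `x`, it also attains it
after two of these vectors are replaced by their normalized sum. -/
theorem norm_apply_update_normalized_sum (f : MultilinearMap ℂ (fun _ : ι => E) ℂ)
    (hsymm : ∀ (σ : Equiv.Perm ι) (v : ι → E), f (v ∘ σ) = f v) {x : ι → E}
    (hx : ∀ i, ‖x i‖ = 1) (hmax : ∀ y : ι → E, (∀ i, ‖y i‖ = 1) → ‖f y‖ ≤ ‖f x‖) {i j : ι}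
    (hij : i ≠ j) (hs : x i + x j ≠ 0) :
    ‖f (Function.update (Function.update x i ((‖x i + x j‖⁻¹ : ℂ) • (x i + x j))) j
      ((‖x i + x j‖⁻¹ : ℂ) • (x i + x j)))‖ = ‖f x‖ := by
  set B : E → E → ℂ := fun a b => f (Function.update (Function.update x i a) j b) with hB
  have hBsymm : ∀ a b, B a b = B b a := by
    intro a b
    rw [hB]
    dsimp only
    rw [← hsymm (Equiv.swap i j)]
    congr 1
    ext k
    rcases eq_or_ne k i with rfl | hki
    · simp [hij]
    rcases eq_or_ne k j with rfl | hkj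
    · simp [hij]
    · simp [Equiv.swap_apply_of_ne_of_ne hki hkj, hki, hkj]
  have hBadd : ∀ a b c, B a (b + c) = B a b + B a c := fun a b c => f.map_update_add _ _ _ _
  have hBsmul : ∀ a (r : ℂ) b, B a (r • b) = r * B a b := fun a r b => f.map_update_smul _ _ _ _
  have hBx : B (x i) (x j) = f x := by simp [hB]
  have hBle : ∀ a, ‖a‖ = 1 → ∀ b, ‖B a b‖ ≤ ‖f x‖ * ‖b‖ := by
    intro a ha b
    rcases eq_or_ne b 0 with rfl | hb
    · have : B a 0 = 0 := f.map_coord_zero j (by simp)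
      simp [this]
    have hb' : ‖b‖ ≠ 0 := norm_ne_zero_iff.2 hb
    have h1 : b = (‖b‖ : ℂ) • ((‖b‖⁻¹ : ℂ) • b) := by
      rw [smul_smul, mul_inv_cancel₀ (by exact_mod_cast hb'), one_smul]
    have h2 : ‖B a ((‖b‖⁻¹ : ℂ) • b)‖ ≤ ‖f x‖ := by
      refine hmax _ fun k => ?_
      rcases eq_or_ne k j with rfl | hkj
      · simp [norm_smul, hb']
      rcases eq_or_ne k i with rfl | hki
      · simp [hkj, ha]
      · simp [hkj, hki, hx]
    rw [h1, hBsmul, norm_mul, mul_comm]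
    have h3 : ‖(‖b‖ : ℂ) • ((‖b‖⁻¹ : ℂ) • b)‖ = ‖b‖ := by rw [← h1]
    rw [h3]
    simpa using mul_le_mul_of_nonneg_right h2 (norm_nonneg b)
  -- The partial forms `B (x i)` and `B (x j)` attain their norm at `x j` and `x i`.
  have h1 : ∀ z, B (x i) z = f x * ⟪x j, z⟫_ℂ := by
    intro z
    have := apply_eq_mul_inner_of_norm_attained
      (⟨⟨B (x i), hBadd _⟩, hBsmul _⟩ : E →ₗ[ℂ] ℂ) (hx j)
      (fun z => by simpa [hBx] using hBle _ (hx i) z) z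
    simpa [hBx] using this
  have h2 : ∀ z, B (x j) z = f x * ⟪x i, z⟫_ℂ := by
    intro z
    have hji : B (x j) (x i) = f x := by rw [hBsymm, hBx]
    have := apply_eq_mul_inner_of_norm_attained
      (⟨⟨B (x j), hBadd _⟩, hBsmul _⟩ : E →ₗ[ℂ] ℂ) (hx i)
      (fun z => by simpa [hji] using hBle _ (hx j) z) z
    simpa [hji] using this
  have h3 : B (x i + x j) (x i + x j) = f x * (‖x i + x j‖ : ℂ) ^ 2 := by
    rw [hBsymm, hBadd, hBsymm, hBsymm _ (x j), h1, h2, ← mul_add, ← inner_add_left,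
      add_comm (x j), inner_self_eq_norm_sq_to_K]
    rfl
  have hs' : (‖x i + x j‖ : ℂ) ≠ 0 := by exact_mod_cast norm_ne_zero_iff.2 hs
  have h4 : B ((‖x i + x j‖⁻¹ : ℂ) • (x i + x j)) ((‖x i + x j‖⁻¹ : ℂ) • (x i + x j)) = f x := by
    rw [hBsmul, hBsymm, hBsmul, h3]
    field_simp
  exact congrArg norm h4

/-- **Banach's theorem**: a bound for a symmetric multilinear form on the diagonal holds at all
families of unit vectors. Among the unit vectors `w` and `x i` such that `x` maximizes `‖f x‖`, choose
those that maximize `∑ i, Re ⟪w, x i⟫`; then the `x i` are all equal, as otherwise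
`norm_apply_update_normalized_sum` would increase this sum. -/
theorem norm_apply_le_of_forall_diagonal [Fintype ι] [Nonempty ι]
    [FiniteDimensional ℂ E]
    (f : ContinuousMultilinearMap ℂ (fun _ : ι => E) ℂ)
    (hsymm : ∀ (σ : Equiv.Perm ι) (v : ι → E), f (v ∘ σ) = f v) {C : ℝ}
    (hC : ∀ v : E, ‖v‖ = 1 → ‖f fun _ => v‖ ≤ C) {y : ι → E} (hy : ∀ i, ‖y i‖ = 1) :
    ‖f y‖ ≤ C := by
  obtain ⟨i₀⟩ := ‹Nonempty ι›
  have : ProperSpace E := FiniteDimensional.proper ℂ E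
  set K : Set (ι → E) := Set.pi Set.univ fun _ => Metric.sphere 0 1 with hK
  have memK : ∀ x, x ∈ K ↔ ∀ i, ‖x i‖ = 1 := by simp [hK]
  have hKc : IsCompact K := isCompact_univ_pi fun _ => isCompact_sphere _ _
  have hfc : Continuous fun x : ι → E => ‖f x‖ := f.cont.norm
  obtain ⟨x₀, hx₀K, hx₀⟩ := hKc.exists_isMaxOn ⟨y, (memK y).2 hy⟩ hfc.continuousOn
  set M : Set (E × (ι → E)) := (Metric.sphere 0 1 ×ˢ K) ∩ {q | ‖f q.2‖ = ‖f x₀‖} with hM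
  have hMc : IsCompact M := ((isCompact_sphere _ _).prod hKc).inter_right
    (isClosed_eq (hfc.comp continuous_snd) continuous_const)
  have memM : ∀ w x, (w, x) ∈ M ↔ ‖w‖ = 1 ∧ (∀ i, ‖x i‖ = 1) ∧ ‖f x‖ = ‖f x₀‖ := by
    simp [hM, memK, and_assoc]
  set pot : E × (ι → E) → ℝ := fun q => ∑ i, (⟪q.1, q.2 i⟫_ℂ).re with hpot
  have hpotc : Continuous pot := by
    rw [hpot]
    fun_prop
  have hx₀1 := (memK x₀).1 hx₀K
  obtain ⟨⟨w, x⟩, hwx, hmax⟩ := hMc.exists_isMaxOn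
    ⟨(x₀ i₀, x₀), (memM _ _).2 ⟨hx₀1 i₀, hx₀1, rfl⟩⟩ hpotc.continuousOn
  obtain ⟨hw, hx, hfx⟩ := (memM _ _).1 hwx
  have hmax' : ∀ w' x', ‖w'‖ = 1 → (∀ i, ‖x' i‖ = 1) → ‖f x'‖ = ‖f x₀‖ →
      ∑ i, (⟪w', x' i⟫_ℂ).re ≤ ∑ i, (⟪w, x i⟫_ℂ).re :=
    fun w' x' h1 h2 h3 => hmax ((memM _ _).2 ⟨h1, h2, h3⟩)
  -- As signs may be changed, maximality persists with absolute values on the left-hand side.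
  have habs : ∀ w', ‖w'‖ = 1 → ∑ i, |(⟪w', x i⟫_ℂ).re| ≤ ∑ i, (⟪w, x i⟫_ℂ).re := by
    intro w' hw'
    set s : ι → ℂ := fun i => if (⟪w', x i⟫_ℂ).re < 0 then -1 else 1 with hs
    have hs1 : ∀ i, ‖s i‖ = 1 := by
      intro i
      simp only [hs]
      split_ifs <;> simp
    convert hmax' w' (fun i => s i • x i) hw' (fun i => by rw [norm_smul, hs1, hx, one_mul])
      (by rw [f.map_smul_univ, norm_smul, norm_prod, Finset.prod_congr rfl fun i _ => hs1 i,
        Finset.prod_const_one, one_mul, hfx]) using 2 with i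
    simp only [hs]
    split_ifs with h
    · rw [abs_of_neg h]
      simp
    · rw [abs_of_nonneg (not_lt.1 h)]
      simp
  have hnonneg : ∀ i, 0 ≤ (⟪w, x i⟫_ℂ).re := by
    intro i
    by_contra! h
    exact absurd (habs w hw) (not_le.2 (Finset.sum_lt_sum (fun k _ => le_abs_self _)
      ⟨i, Finset.mem_univ _, h.trans_le (abs_nonneg _)⟩))
  have hpos : ∃ i, 0 < (⟪w, x i⟫_ℂ).re := by
    by_contra! h
    have h1 : ∑ i, (⟪w, x i⟫_ℂ).re ≤ 0 := Finset.sum_nonpos fun i _ => h i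
    have h2 : (1 : ℝ) ≤ ∑ i, |(⟪x i₀, x i⟫_ℂ).re| := by
      refine le_trans ?_ (Finset.single_le_sum (f := fun i => |(⟪x i₀, x i⟫_ℂ).re|)
        (fun i _ => abs_nonneg _) (Finset.mem_univ i₀))
      simp [inner_self_eq_norm_sq_to_K, hx]
    linarith [habs _ (hx i₀)]
  obtain ⟨i, hi⟩ := hpos
  have heq : ∀ j, x j = x i := by
    intro j
    by_contra hne
    have hij : i ≠ j := by
      rintro rfl
      exact hne rfl
    have hre : 0 < (⟪w, x i + x j⟫_ℂ).re := by
      rw [inner_add_right, Complex.add_re]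
      linarith [hnonneg j]
    have hs : x i + x j ≠ 0 := by
      intro h
      simp [h] at hre
    have hspos : 0 < ‖x i + x j‖ := norm_pos_iff.2 hs
    have hlt : ‖x i + x j‖ < 2 := by
      have h1 := parallelogram_law_with_norm ℂ (x i) (x j)
      rw [hx, hx] at h1
      have h2 : 0 < ‖x i - x j‖ := norm_pos_iff.2 (sub_ne_zero.2 (Ne.symm hne))
      nlinarith
    set u : E := (‖x i + x j‖⁻¹ : ℂ) • (x i + x j) with hu
    have hu1 : ‖u‖ = 1 := by
      rw [hu, norm_smul]
      simp [hspos.ne']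
    have hfu := norm_apply_update_normalized_sum f.toMultilinearMap hsymm hx
      (fun z hz => hfx.symm ▸ hx₀ ((memK z).2 hz)) hij hs
    have hbig := hmax' w (Function.update (Function.update x i u) j u) hw (fun k => by
      rcases eq_or_ne k j with rfl | hkj
      · simp [hu1]
      rcases eq_or_ne k i with rfl | hki
      · simp [hkj, hu1]
      · simp [hkj, hki, hx]) (hfu.trans hfx)
    have hdecomp : ∀ z : ι → E, ∑ k, (⟪w, z k⟫_ℂ).re = (⟪w, z i⟫_ℂ).re + (⟪w, z j⟫_ℂ).re
        + ∑ k ∈ (Finset.univ.erase i).erase j, (⟪w, z k⟫_ℂ).re := by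
      intro z
      rw [← Finset.add_sum_erase _ _ (Finset.mem_univ i),
        ← Finset.add_sum_erase _ _ (Finset.mem_erase.2 ⟨hij.symm, Finset.mem_univ j⟩), add_assoc]
    rw [hdecomp, hdecomp x] at hbig
    have hrest : ∑ k ∈ (Finset.univ.erase i).erase j,
        (⟪w, Function.update (Function.update x i u) j u k⟫_ℂ).re
        = ∑ k ∈ (Finset.univ.erase i).erase j, (⟪w, x k⟫_ℂ).re := by
      refine Finset.sum_congr rfl fun k hk => ?_
      simp only [Finset.mem_erase] at hk
      rw [Function.update_of_ne hk.1, Function.update_of_ne hk.2.1]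
    rw [hrest] at hbig
    have hwu : (⟪w, u⟫_ℂ).re = (⟪w, x i + x j⟫_ℂ).re / ‖x i + x j‖ := by
      rw [hu, inner_smul_right, ← Complex.ofReal_inv, Complex.re_ofReal_mul]
      ring
    rw [inner_add_right, Complex.add_re] at hwu hre
    simp only [Function.update_self, Function.update_of_ne hij] at hbig
    rw [hwu] at hbig
    have : (⟪w, x i⟫_ℂ).re + (⟪w, x j⟫_ℂ).re
        < 2 * (((⟪w, x i⟫_ℂ).re + (⟪w, x j⟫_ℂ).re) / ‖x i + x j‖) := by
      rw [← mul_div_assoc, lt_div_iff₀ hspos]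
      nlinarith
    linarith
  have hconst : x = fun _ => x i := funext heq
  calc ‖f y‖ ≤ ‖f x₀‖ := hx₀ ((memK y).2 hy)
    _ = ‖f fun _ => x i‖ := by rw [← hfx, ← hconst]
    _ ≤ C := hC _ (hx i)

end Banach

/-! ### A bound for products with prescribed sum and sum of squares -/

/-- The quadratic polynomial that touches `log` at `1 / 4` and meets it at `1` dominates it on
`(0, 1]`. -/
theorem log_le_quadratic {p : ℝ} (h0 : 0 < p) (h1 : p ≤ 1) :
    Real.log p ≤ -Real.log 4 + 4 * (p - 1 / 4)
      + 16 * (Real.log 4 - 3) / 9 * (p - 1 / 4) ^ 2 := by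
  have hL0 : 1.38 < Real.log 4 := by
    rw [show (4 : ℝ) = 2 ^ 2 by norm_num, Real.log_pow]
    norm_num
    linarith [Real.log_two_gt_d9]
  have hL1 : Real.log 4 < 1.39 := by
    rw [show (4 : ℝ) = 2 ^ 2 by norm_num, Real.log_pow]
    norm_num
    linarith [Real.log_two_lt_d9]
  set κ : ℝ := 16 * (Real.log 4 - 3) / 9 with hκ
  have hκ0 : κ < -2.8 := by rw [hκ]; norm_num at *; linarith
  have hκ1 : -2.9 < κ := by rw [hκ]; norm_num at *; linarith
  set h : ℝ → ℝ := fun x => -Real.log 4 + 4 * (x - 1 / 4) + κ * (x - 1 / 4) ^ 2 - Real.log x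
    with hh
  have hder : ∀ x : ℝ, 0 < x → HasDerivAt h ((x - 1 / 4) * (4 + 2 * κ * x) / x) x := by
    intro x hx
    have h2 := (((((hasDerivAt_id x).sub_const (1 / 4)).const_mul 4).const_add
      (-Real.log 4)).add ((((hasDerivAt_id x).sub_const (1 / 4)).pow 2).const_mul κ)).sub
      (Real.hasDerivAt_log hx.ne')
    refine h2.congr_deriv ?_
    field_simp
    simp
    ring
  have hq : h (1 / 4) = 0 := by
    have : Real.log (1 / 4) = -Real.log 4 := by rw [one_div, Real.log_inv]
    simp only [hh, this]
    ring
  have hone : h 1 = 0 := by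
    simp only [hh, hκ, Real.log_one]
    ring
  have hcont : ∀ x, 0 < x → ContinuousAt h x := fun x hx => (hder x hx).continuousAt
  -- `m` is the second zero of the derivative of `h`, which lies between `1 / 4` and `1`.
  set m : ℝ := -2 / κ with hm
  have hm0 : 1 / 4 < m := by
    rw [hm, lt_div_iff_of_neg (by linarith)]
    linarith
  have hm1 : m < 1 := by
    rw [hm, div_lt_iff_of_neg (by linarith)]
    norm_num at *
    linarith
  have hfac : ∀ x, 4 + 2 * κ * x = 2 * κ * (x - m) := by
    intro x
    rw [hm]
    have : κ ≠ 0 := by linarith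
    field_simp
    ring
  suffices 0 ≤ h p by simp only [hh] at this; linarith
  rcases le_total p (1 / 4) with hp | hp
  · have hanti : AntitoneOn h (Set.Icc p (1 / 4)) := by
      refine antitoneOn_of_deriv_nonpos (convex_Icc _ _)
        (fun x hx => (hcont x (by linarith [hx.1])).continuousWithinAt)
        (fun x hx => ?_) (fun x hx => ?_)
      all_goals
        rw [interior_Icc] at hx
        have hx0 : 0 < x := h0.trans hx.1
      · exact (hder x hx0).differentiableAt.differentiableWithinAt
      · rw [(hder x hx0).deriv, hfac]
        refine div_nonpos_of_nonpos_of_nonneg ?_ hx0.le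
        have h3 : 0 ≤ 2 * κ * (x - m) := by nlinarith [hx.2]
        nlinarith [hx.2]
    rw [← hq]
    exact hanti ⟨le_rfl, hp⟩ ⟨hp, le_rfl⟩ hp
  rcases le_total p m with hpm | hpm
  · have hmono : MonotoneOn h (Set.Icc (1 / 4) m) := by
      refine monotoneOn_of_deriv_nonneg (convex_Icc _ _)
        (fun x hx => (hcont x (by linarith [hx.1])).continuousWithinAt)
        (fun x hx => ?_) (fun x hx => ?_)
      all_goals
        rw [interior_Icc] at hx
        have hx0 : 0 < x := by linarith [hx.1]
      · exact (hder x hx0).differentiableAt.differentiableWithinAt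
      · rw [(hder x hx0).deriv, hfac]
        refine div_nonneg (mul_nonneg (by linarith [hx.1]) ?_) hx0.le
        nlinarith [hx.2]
    rw [← hq]
    exact hmono ⟨le_rfl, hm0.le⟩ ⟨hp, hpm⟩ hp
  · have hanti : AntitoneOn h (Set.Icc m 1) := by
      refine antitoneOn_of_deriv_nonpos (convex_Icc _ _)
        (fun x hx => (hcont x (by linarith [hx.1])).continuousWithinAt)
        (fun x hx => ?_) (fun x hx => ?_)
      all_goals
        rw [interior_Icc] at hx
        have hx0 : 0 < x := by linarith [hx.1]
      · exact (hder x hx0).differentiableAt.differentiableWithinAt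
      · rw [(hder x hx0).deriv, hfac]
        refine div_nonpos_of_nonpos_of_nonneg ?_ hx0.le
        have h3 : 2 * κ * (x - m) ≤ 0 := by nlinarith [hx.1]
        nlinarith [hx.1]
    rw [← hone]
    exact hanti ⟨hpm, h1⟩ ⟨hm1.le, le_rfl⟩ h1

/-- Nine numbers in `[0, 1]` with sum `3` and sum of squares `3 / 2` have product at most `4⁻⁸`,
the product of `1` and eight times `1 / 4`. -/
theorem prod_le_of_sum_of_sum_sq {ι : Type*} [Fintype ι] (hcard : Fintype.card ι = 9) (p : ι → ℝ)
    (h0 : ∀ i, 0 ≤ p i) (h1 : ∀ i, p i ≤ 1) (hsum : ∑ i, p i = 3)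
    (hsq : ∑ i, p i ^ 2 = 3 / 2) : ∏ i, p i ≤ 1 / 4 ^ 8 := by
  by_cases hz : ∃ i, p i = 0
  · obtain ⟨i, hi⟩ := hz
    rw [Finset.prod_eq_zero (Finset.mem_univ i) hi]
    positivity
  push Not at hz
  have hpos : ∀ i, 0 < p i := fun i => (h0 i).lt_of_ne (hz i).symm
  rw [← Real.log_le_log_iff (Finset.prod_pos fun i _ => hpos i) (by positivity),
    Real.log_prod fun i _ => hz i]
  refine (Finset.sum_le_sum fun i _ => log_le_quadratic (hpos i) (h1 i)).trans_eq ?_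
  set κ := 16 * (Real.log 4 - 3) / 9 with hκ
  have : ∀ i, -Real.log 4 + 4 * (p i - 1 / 4) + κ * (p i - 1 / 4) ^ 2
      = (-Real.log 4 - 1 + κ / 16) + (4 - κ / 2) * p i + κ * p i ^ 2 := fun i => by ring
  simp_rw [this]
  rw [Finset.sum_add_distrib, Finset.sum_add_distrib, ← Finset.mul_sum, ← Finset.mul_sum, hsum,
    hsq, Finset.sum_const, Finset.card_univ, hcard, one_div, Real.log_inv, Real.log_pow, hκ]
  simp
  ring

/-! ### Permanents, overlaps with product states, and their invariance -/

section Permanent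

variable {ι : Type} [Fintype ι] [DecidableEq ι] {d : ℕ}

theorem permanent_of_mul_permute (a b : ι → ℂ) (σ τ : Equiv.Perm ι) (M : Matrix ι ι ℂ) :
    (Matrix.of fun j k => a j * b k * M (σ j) (τ k)).permanent
      = (∏ j, a j) * (∏ k, b k) * M.permanent := by
  have hM : M.permanent = (M.submatrix σ τ).permanent := by
    rw [← Matrix.permanent_permute_cols σ M,
      ← Matrix.permanent_permute_rows τ (M.submatrix σ id), Matrix.submatrix_submatrix]
    rfl
  rw [hM, Matrix.permanent, Matrix.permanent, Finset.mul_sum]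
  refine Finset.sum_congr rfl fun π _ => ?_
  simp only [Matrix.of_apply, Matrix.submatrix_apply, Finset.prod_mul_distrib]
  rw [Equiv.prod_comp π]

theorem permanent_map_ringHom (τ : ℂ →+* ℂ) (M : Matrix ι ι ℂ) :
    (M.map τ).permanent = τ M.permanent := by
  simp [Matrix.permanent, map_sum, map_prod]

theorem inner_prodKet_prodKet (a b : ι → Ket d) :
    ⟪prodKet a, prodKet b⟫_ℂ = ∏ k, ⟪a k, b k⟫_ℂ := by
  simp only [prodKet, PiLp.inner_apply, RCLike.inner_apply, map_prod, ← Finset.prod_mul_distrib]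
  exact (Finset.prod_univ_sum (fun _ => Finset.univ) fun k i => b k i * starRingEnd ℂ (a k i)).symm

/-- The matrix of the overlaps `⟨x_k|ψ_j⟩`; its permanent is, up to a factor, the overlap of
`⨂_k x_k` with the symmetrization of `⨂_j ψ_j`. -/
def crossGram (x ψ : ι → Ket d) : Matrix ι ι ℂ := Matrix.of fun j k => ⟪x k, ψ j⟫_ℂ

theorem inner_prodKet_symProj (x ψ : ι → Ket d) :
    ⟪prodKet x, symProj (prodKet ψ)⟫_ℂ
      = (1 / ((Fintype.card ι).factorial : ℂ)) * (crossGram x ψ).permanent := by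
  rw [symProj_prodKet, inner_smul_right, inner_sum]
  simp only [inner_prodKet_prodKet, Matrix.permanent, crossGram, Matrix.of_apply]

theorem normSq_inner_prodKet_symState (x ψ : ι → Ket d)
    (hpos : 0 ≤ (Matrix.gram ℂ ψ).permanent.re) :
    ‖⟪prodKet x, symState ψ⟫_ℂ‖ ^ 2 = ((Fintype.card ι).factorial / (Matrix.gram ℂ ψ).permanent.re)
      * ‖(1 / ((Fintype.card ι).factorial : ℂ)) * (crossGram x ψ).permanent‖ ^ 2 := by
  rw [symState, inner_smul_right, inner_prodKet_symProj, norm_mul, mul_pow, Complex.norm_real,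
    Real.norm_eq_abs, sq_abs, Real.sq_sqrt (by positivity)]

/-- Equivalence through a bijection `W` of the kets that preserves inner products up to an
automorphism `τ` of `ℂ`: the identity if `W` is unitary, conjugation if it is antiunitary. -/
theorem Equivalent.exists_equiv {κ : Type} {ψ φ : κ → Ket d} (h : Equivalent ψ φ) :
    ∃ (σ : Equiv.Perm κ) (c : κ → ℂ) (W : Ket d ≃ Ket d) (τ : ℂ →+* ℂ), (∀ j, ‖c j‖ = 1) ∧
      (∀ j, φ (σ j) = c j • W (ψ j)) ∧ (∀ x y, ⟪W x, W y⟫_ℂ = τ ⟪x, y⟫_ℂ) ∧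
      (∀ x, ‖W x‖ = ‖x‖) ∧ (∀ z, ‖τ z‖ = ‖z‖) ∧ ∀ z, (τ z).re = z.re := by
  obtain ⟨σ, c, hc, hU⟩ := h
  have hinv : ∀ j (x y : Ket d), x = c j • y → y = (c j)⁻¹ • x := by
    rintro j x y rfl
    have : c j ≠ 0 := norm_ne_zero_iff.1 (by rw [hc]; exact one_ne_zero)
    rw [smul_smul, inv_mul_cancel₀ this, one_smul]
  rcases hU with ⟨U, hU⟩ | ⟨U, hU⟩
  · exact ⟨σ, fun j => (c j)⁻¹, U.toEquiv, RingHom.id ℂ, fun j => by simp [hc],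
      fun j => hinv j _ _ (hU j), fun x y => U.inner_map_map x y, U.norm_map, fun _ => rfl,
      fun _ => rfl⟩
  · refine ⟨σ, fun j => (c j)⁻¹, U.toEquiv, starRingEnd ℂ, fun j => by simp [hc],
      fun j => hinv j _ _ (hU j), fun x y => ?_, U.norm_map, fun z => by simp, fun z => by simp⟩
    have h1 : ‖U x + Complex.I • U y‖ = ‖x - Complex.I • y‖ := by
      rw [← U.norm_map (x - Complex.I • y), map_sub, U.map_smulₛₗ]
      simp
    have h2 : ‖U x - Complex.I • U y‖ = ‖x + Complex.I • y‖ := by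
      rw [← U.norm_map (x + Complex.I • y), map_add, U.map_smulₛₗ]
      simp [sub_eq_add_neg]
    change ⟪U x, U y⟫_ℂ = _
    rw [inner_eq_sum_norm_sq_div_four, inner_eq_sum_norm_sq_div_four x y]
    simp only [RCLike.I_to_complex] at *
    rw [h1, h2, ← map_add, ← map_sub, U.norm_map, U.norm_map]
    simp [map_ofNat]
    ring

theorem Equivalent.permanent_gram_re_eq {ψ φ : ι → Ket d} (h : Equivalent ψ φ) :
    (Matrix.gram ℂ ψ).permanent.re = (Matrix.gram ℂ φ).permanent.re := by
  obtain ⟨σ, c, W, τ, hc, hφ, hW, -, -, hτ⟩ := h.exists_equiv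
  have h1 : (Matrix.of fun j k => starRingEnd ℂ (c j) * c k
        * ((Matrix.gram ℂ ψ).map τ) (Equiv.refl ι j) (Equiv.refl ι k))
      = (Matrix.gram ℂ φ).submatrix σ σ := by
    ext j k
    simp only [Matrix.of_apply, Matrix.submatrix_apply, Matrix.gram_apply, hφ, inner_smul_left,
      inner_smul_right, hW, Matrix.map_apply, Equiv.refl_apply]
    ring
  have h2 := congrArg Matrix.permanent h1
  rw [permanent_of_mul_permute, permanent_map_ringHom, ← map_prod, Complex.conj_mul', norm_prod,
    Finset.prod_congr rfl fun j _ => hc j] at h2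
  have h3 : ((Matrix.gram ℂ φ).submatrix σ σ).permanent = (Matrix.gram ℂ φ).permanent := by
    rw [← one_mul (Matrix.gram ℂ φ).permanent]
    convert permanent_of_mul_permute 1 1 σ σ (Matrix.gram ℂ φ) using 2
    · ext j k
      simp
    · simp
  rw [h3] at h2
  rw [← h2]
  simp [hτ]

theorem Equivalent.exists_norm_permanent_crossGram_eq {ψ φ : ι → Ket d} (h : Equivalent ψ φ) :
    ∃ W : Ket d ≃ Ket d, (∀ x, ‖W x‖ = ‖x‖) ∧ ∀ x : ι → Ket d,
      ‖(crossGram (fun k => W (x k)) φ).permanent‖ = ‖(crossGram x ψ).permanent‖ := by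
  obtain ⟨σ, c, W, τ, hc, hφ, hW, hWn, hτ, -⟩ := h.exists_equiv
  refine ⟨W, hWn, fun x => ?_⟩
  have h1 : (Matrix.of fun j k => c j * 1 * ((crossGram x ψ).map τ) (Equiv.refl ι j)
      (Equiv.refl ι k)) = (crossGram (fun k => W (x k)) φ).submatrix σ id := by
    ext j k
    simp [crossGram, hφ, hW]
  have h2 := congrArg (fun M => ‖Matrix.permanent M‖) h1
  rw [permanent_of_mul_permute c (fun _ => 1), permanent_map_ringHom,
    Matrix.permanent_permute_cols] at h2
  rw [← h2]
  simp [norm_prod, hc, hτ]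

/-- The geometric measure of entanglement of the symmetrized state depends only on the equivalence
class of the family of kets. -/
theorem Equivalent.geometricMeasure_symState_eq {ψ φ : ι → Ket d} (h : Equivalent ψ φ)
    (hpos : 0 ≤ (Matrix.gram ℂ ψ).permanent.re) :
    geometricMeasure (symState ψ) = geometricMeasure (symState φ) := by
  obtain ⟨W, hWn, hW⟩ := h.exists_norm_permanent_crossGram_eq
  have hperm := h.permanent_gram_re_eq
  have key : ∀ x : ι → Ket d, ‖⟪prodKet x, symState ψ⟫_ℂ‖ ^ 2
      = ‖⟪prodKet (fun k => W (x k)), symState φ⟫_ℂ‖ ^ 2 := by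
    intro x
    rw [normSq_inner_prodKet_symState _ _ hpos, normSq_inner_prodKet_symState _ _ (hperm ▸ hpos),
      norm_mul, norm_mul, hW, hperm]
  have hset : overlapSet (symState ψ) = overlapSet (symState φ) := by
    ext r
    constructor
    · rintro ⟨x, hx, rfl⟩
      exact ⟨fun k => W (x k), fun k => by rw [hWn, hx], key x⟩
    · rintro ⟨x, hx, rfl⟩
      exact ⟨fun k => W.symm (x k), fun k => by rw [← hWn, W.apply_symm_apply, hx],
        by rw [key]; simp⟩
  rw [geometricMeasure, geometricMeasure, maxOverlapSq, maxOverlapSq, hset]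

/-- The overlap of a symmetrized product state with a product state is bounded as soon as it is
bounded for the powers of a single ket. -/
theorem norm_permanent_crossGram_le [Nonempty ι] (ψ : ι → Ket d) {C : ℝ}
    (hC : ∀ v : Ket d, ‖v‖ = 1 → ∏ j, ‖⟪v, ψ j⟫_ℂ‖ ≤ C) (x : ι → Ket d) (hx : ∀ k, ‖x k‖ = 1) :
    ‖(1 / ((Fintype.card ι).factorial : ℂ)) * (crossGram x ψ).permanent‖ ≤ C := by
  -- The conjugate of the overlap is a symmetric multilinear form in `x`.
  set f : ContinuousMultilinearMap ℂ (fun _ : ι => Ket d) ℂ :=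
    (1 / ((Fintype.card ι).factorial : ℂ)) • ∑ σ : Equiv.Perm ι,
      (ContinuousMultilinearMap.mkPiAlgebra ℂ ι ℂ).compContinuousLinearMap
        fun k => innerSL ℂ (ψ (σ k)) with hf
  have hfx : ∀ x, f x = (1 / ((Fintype.card ι).factorial : ℂ))
      * ∑ σ : Equiv.Perm ι, ∏ k, ⟪ψ (σ k), x k⟫_ℂ := by
    intro x
    simp [hf]
  have hfp : ∀ x, f x = starRingEnd ℂ
      ((1 / ((Fintype.card ι).factorial : ℂ)) * (crossGram x ψ).permanent) := by
    intro x
    simp [hfx, Matrix.permanent, crossGram]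
  have hsymm : ∀ (σ : Equiv.Perm ι) (v : ι → Ket d), f (v ∘ σ) = f v := by
    intro σ v
    rw [hfx, hfx]
    congr 1
    refine Fintype.sum_equiv (Equiv.mulRight σ⁻¹) _ _ fun π => ?_
    exact Fintype.prod_equiv σ _ _ fun k => by simp
  have hdiag : ∀ v : Ket d, ‖v‖ = 1 → ‖f fun _ => v‖ ≤ C := by
    intro v hv
    refine le_trans (le_of_eq ?_) (hC v hv)
    have h1 : ∀ σ : Equiv.Perm ι, ∏ k, ⟪ψ (σ k), v⟫_ℂ = ∏ k, ⟪ψ k, v⟫_ℂ :=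
      fun σ => Equiv.prod_comp σ fun k => ⟪ψ k, v⟫_ℂ
    have h2 : ((Fintype.card ι).factorial : ℂ) ≠ 0 := by
      exact_mod_cast (Nat.factorial_pos _).ne'
    rw [hfx, Finset.sum_congr rfl fun σ _ => h1 σ, Finset.sum_const, Finset.card_univ,
      Fintype.card_perm, nsmul_eq_mul, ← mul_assoc, one_div, inv_mul_cancel₀ h2, one_mul, norm_prod]
    exact Finset.prod_congr rfl fun k _ => norm_inner_symm _ _
  have := norm_apply_le_of_forall_diagonal f hsymm hdiag hx
  rwa [hfp, RCLike.norm_conj] at this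

theorem norm_permanent_crossGram_const (ψ : ι → Ket d) (v : Ket d) :
    ‖(1 / ((Fintype.card ι).factorial : ℂ)) * (crossGram (fun _ => v) ψ).permanent‖
      = ∏ j, ‖⟪v, ψ j⟫_ℂ‖ := by
  have h1 : ∀ σ : Equiv.Perm ι, ∏ k, ⟪v, ψ (σ k)⟫_ℂ = ∏ k, ⟪v, ψ k⟫_ℂ :=
    fun σ => Equiv.prod_comp σ fun k => ⟪v, ψ k⟫_ℂ
  have h2 : ((Fintype.card ι).factorial : ℂ) ≠ 0 := by
    exact_mod_cast (Nat.factorial_pos _).ne'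
  simp only [Matrix.permanent, crossGram, Matrix.of_apply]
  rw [Finset.sum_congr rfl fun σ _ => h1 σ, Finset.sum_const, Finset.card_univ,
    Fintype.card_perm, nsmul_eq_mul, ← mul_assoc, one_div, inv_mul_cancel₀ h2, one_mul, norm_prod]

/-- If the product of the overlaps of a ket with the `ψ_j` is maximal at the unit vector `v`, then
`v ⊗ ⋯ ⊗ v` is a closest product state of the symmetrized state. -/
theorem maxOverlapSq_symState [Nonempty ι] (ψ : ι → Ket d)
    (hpos : 0 ≤ (Matrix.gram ℂ ψ).permanent.re) {v : Ket d} (hv : ‖v‖ = 1)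
    (hmax : ∀ w : Ket d, ‖w‖ = 1 → ∏ j, ‖⟪w, ψ j⟫_ℂ‖ ≤ ∏ j, ‖⟪v, ψ j⟫_ℂ‖) :
    maxOverlapSq (symState ψ) = ((Fintype.card ι).factorial / (Matrix.gram ℂ ψ).permanent.re)
      * (∏ j, ‖⟪v, ψ j⟫_ℂ‖) ^ 2 := by
  refine IsGreatest.csSup_eq ⟨⟨fun _ => v, fun _ => hv, ?_⟩, ?_⟩
  · rw [normSq_inner_prodKet_symState _ _ hpos, norm_permanent_crossGram_const]
  · rintro r ⟨x, hx, rfl⟩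
    rw [normSq_inner_prodKet_symState _ _ hpos]
    have := norm_permanent_crossGram_le ψ hmax x hx
    gcongr

end Permanent

/-! ### The permanent of a Gram matrix from the coefficients of a product of linear forms -/

section Fischer

variable {ι : Type} [Fintype ι] [DecidableEq ι] {d : ℕ}

/-- The product `∏_j ∑_i ψ_j(i) X_i` of the linear forms with the coordinates of the kets `ψ_j` as
coefficients. -/
def formProd (ψ : ι → Ket d) : MvPolynomial (Fin d) ℂ :=
  ∏ j, ∑ i, MvPolynomial.C (ψ j i) * MvPolynomial.X i

/-- The exponent of the monomial `∏_j X_{f j}`. -/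
def typeOf (f : ι → Fin d) : Fin d →₀ ℕ := ∑ j, Finsupp.single (f j) 1

theorem typeOf_apply {κ : Type} [Fintype κ] (f : κ → Fin d) (i : Fin d) :
    typeOf f i = Fintype.card {j // f j = i} := by
  simp [typeOf, Finsupp.single_apply, Fintype.card_subtype]

theorem coeff_formProd (ψ : ι → Ket d) (α : Fin d →₀ ℕ) :
    (formProd ψ).coeff α = ∑ f : ι → Fin d, if typeOf f = α then ∏ j, ψ j (f j) else 0 := by
  have h : formProd ψ = ∑ f : ι → Fin d, MvPolynomial.monomial (typeOf f) (∏ j, ψ j (f j)) := by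
    rw [formProd, Finset.prod_univ_sum, Fintype.piFinset_univ]
    refine Finset.sum_congr rfl fun f _ => ?_
    rw [typeOf, MvPolynomial.monomial_sum_index, Finset.prod_mul_distrib, map_prod]
    rfl
  simp [h, MvPolynomial.coeff_sum, MvPolynomial.coeff_monomial]

/-- The number of permutations carrying `f` to `g` is the order of the stabilizer of `f` if `f` and
`g` take each value equally often. -/
theorem card_perm_comp_eq (f g : ι → Fin d) :
    (Finset.univ.filter fun σ : Equiv.Perm ι => f ∘ σ = g).card
      = if typeOf f = typeOf g then ∏ i, (typeOf f i).factorial else 0 := by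
  split_ifs with h
  · have hex : ∃ σ₀ : Equiv.Perm ι, f ∘ σ₀ = g := by
      have hcard : ∀ i, Nonempty ({j // g j = i} ≃ {j // f j = i}) := fun i =>
        ⟨Fintype.equivOfCardEq (by rw [← typeOf_apply, ← typeOf_apply, h])⟩
      refine ⟨(Equiv.sigmaFiberEquiv g).symm.trans ((Equiv.sigmaCongrRight fun i =>
        (hcard i).some).trans (Equiv.sigmaFiberEquiv f)), ?_⟩
      ext j
      exact congrArg _ ((hcard (g j)).some ⟨j, rfl⟩).2
    obtain ⟨σ₀, rfl⟩ := hex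
    have hstab := DomMulAct.stabilizer_card f
    simp_rw [typeOf_apply]
    rw [← hstab, Fintype.card_subtype]
    refine Finset.card_bij' (fun σ _ => σ * σ₀⁻¹) (fun σ _ => σ * σ₀) ?_ ?_ ?_ ?_
    · intro σ hσ
      simp only [Finset.mem_filter, Finset.mem_univ, true_and] at hσ ⊢
      ext j
      have := congrFun hσ (σ₀⁻¹ j)
      simpa using congrArg Fin.val this
    · intro σ hσ
      simp only [Finset.mem_filter, Finset.mem_univ, true_and] at hσ ⊢
      ext j
      have := congrFun hσ (σ₀ j)
      simpa using congrArg Fin.val this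
    · intro σ _
      simp
    · intro σ _
      simp
  · rw [Finset.card_eq_zero, Finset.filter_eq_empty_iff]
    rintro σ - rfl
    exact h (Equiv.sum_comp σ fun j => Finsupp.single (f j) 1).symm

/-- The permanent of a Gram matrix is the squared Fischer norm of the product of the corresponding
linear forms: the sum of `α! |c_α|²` over the coefficients `c_α`. -/
theorem permanent_gram_eq_sum_coeff (ψ : ι → Ket d) (S : Finset (Fin d →₀ ℕ))
    (hS : (formProd ψ).support ⊆ S) :
    (Matrix.gram ℂ ψ).permanent = ((∑ α ∈ S, ((∏ i, (α i).factorial : ℕ) : ℝ)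
      * ‖(formProd ψ).coeff α‖ ^ 2 : ℝ) : ℂ) := by
  set a : (ι → Fin d) → ℂ := fun f => ∏ j, ψ j (f j) with ha
  have hinner : ∀ j k, (Matrix.gram ℂ ψ) j k = ∑ i, starRingEnd ℂ (ψ j i) * ψ k i := by
    intro j k
    simp [Matrix.gram_apply, PiLp.inner_apply, mul_comm]
  have h1 : (Matrix.gram ℂ ψ).permanent
      = ∑ f : ι → Fin d, a f * starRingEnd ℂ (∑ σ : Equiv.Perm ι, a (f ∘ σ)) := by
    simp only [Matrix.permanent, hinner, Finset.prod_univ_sum, Fintype.piFinset_univ, map_sum,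
      Finset.mul_sum]
    rw [Finset.sum_comm]
    refine Finset.sum_congr rfl fun f _ => ?_
    refine Fintype.sum_equiv (Equiv.inv _) _ _ fun σ => ?_
    rw [Finset.prod_mul_distrib, mul_comm, ha]
    simp only [map_prod, Function.comp_apply]
    congr 1
    exact Fintype.prod_equiv σ _ _ fun k => by simp
  have h2 : ∀ f : ι → Fin d, ∑ σ : Equiv.Perm ι, a (f ∘ σ)
      = ((∏ i, (typeOf f i).factorial : ℕ) : ℂ) * (formProd ψ).coeff (typeOf f) := by
    intro f
    rw [← Finset.sum_fiberwise Finset.univ (fun σ : Equiv.Perm ι => f ∘ σ), coeff_formProd,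
      Finset.mul_sum]
    refine Finset.sum_congr rfl fun g _ => ?_
    rw [Finset.sum_congr rfl (g := fun _ => a g) fun σ hσ => by
      rw [(Finset.mem_filter.1 hσ).2], Finset.sum_const, card_perm_comp_eq, nsmul_eq_mul]
    by_cases h : typeOf f = typeOf g
    · simp [h, ha]
    · simp [h, Ne.symm h]
  have h3 : ∀ f : ι → Fin d, a f * starRingEnd ℂ (∑ σ : Equiv.Perm ι, a (f ∘ σ))
      = ∑ α ∈ S, (if typeOf f = α then a f else 0)
        * (((∏ i, (α i).factorial : ℕ) : ℂ) * starRingEnd ℂ ((formProd ψ).coeff α)) := by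
    intro f
    simp only [ite_mul, zero_mul]
    rw [Finset.sum_ite_eq, h2, map_mul, map_natCast]
    split_ifs with h
    · rfl
    · have : (formProd ψ).coeff (typeOf f) = 0 := by
        by_contra h'
        exact h (hS (MvPolynomial.mem_support_iff.2 h'))
      simp [this]
  rw [h1, Finset.sum_congr rfl fun f _ => h3 f, Finset.sum_comm]
  push_cast
  refine Finset.sum_congr rfl fun α _ => ?_
  rw [← Finset.sum_mul, ← coeff_formProd, ← Complex.mul_conj']
  ring

/-- The formula of `permanent_gram_eq_sum_coeff` for an explicit list of monomials. -/
theorem permanent_gram_of_formProd_eq {κ : Type} [Fintype κ] (ψ : ι → Ket d)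
    (α : κ → Fin d →₀ ℕ) (hα : Function.Injective α) (c : κ → ℂ)
    (h : formProd ψ = ∑ i, MvPolynomial.monomial (α i) (c i)) :
    (Matrix.gram ℂ ψ).permanent
      = ((∑ i, ((∏ k, (α i k).factorial : ℕ) : ℝ) * ‖c i‖ ^ 2 : ℝ) : ℂ) := by
  classical
  have hc : ∀ i, (formProd ψ).coeff (α i) = c i := by
    intro i
    simp [h, MvPolynomial.coeff_sum, MvPolynomial.coeff_monomial, hα.eq_iff]
  rw [permanent_gram_eq_sum_coeff ψ (Finset.univ.image α), Finset.sum_image fun i _ j _ hij => hα hij]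
  · simp only [hc]
  · intro β hβ
    rw [MvPolynomial.mem_support_iff, h, MvPolynomial.coeff_sum] at hβ
    obtain ⟨i, -, hi⟩ := Finset.exists_ne_zero_of_sum_ne_zero hβ
    rw [MvPolynomial.coeff_monomial] at hi
    exact Finset.mem_image.2 ⟨i, Finset.mem_univ i, by_contra fun hne => hi (if_neg hne)⟩

end Fischer

/-! ### Unitary equivalence -/

section UnitarilyEquivalent

variable {ι : Type} {d : ℕ}

/-- Equivalence of two families of kets through a unitary operator. -/
def UnitarilyEquivalent (ψ φ : ι → Ket d) : Prop :=
  ∃ (σ : Equiv.Perm ι) (c : ι → ℂ), (∀ j, ‖c j‖ = 1) ∧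
    ∃ U : Ket d ≃ₗᵢ[ℂ] Ket d, ∀ j, U (ψ j) = c j • φ (σ j)

theorem UnitarilyEquivalent.equivalent {ψ φ : ι → Ket d} (h : UnitarilyEquivalent ψ φ) :
    Equivalent ψ φ := by
  obtain ⟨σ, c, hc, hU⟩ := h
  exact ⟨σ, c, hc, Or.inl hU⟩

theorem UnitarilyEquivalent.trans {ψ φ χ : ι → Ket d} (h : UnitarilyEquivalent ψ φ)
    (h' : UnitarilyEquivalent φ χ) : UnitarilyEquivalent ψ χ := by
  obtain ⟨σ, c, hc, U, hU⟩ := h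
  obtain ⟨σ', c', hc', U', hU'⟩ := h'
  refine ⟨σ.trans σ', fun j => c j * c' (σ j), fun j => by simp [hc, hc'], U.trans U', fun j => ?_⟩
  simp [hU, hU', mul_smul]

theorem UnitarilyEquivalent.symm {ψ φ : ι → Ket d} (h : UnitarilyEquivalent ψ φ) :
    UnitarilyEquivalent φ ψ := by
  obtain ⟨σ, c, hc, U, hU⟩ := h
  refine ⟨σ.symm, fun j => (c (σ.symm j))⁻¹, fun j => by simp [hc], U.symm, fun j => ?_⟩
  have hne : c (σ.symm j) ≠ 0 := norm_ne_zero_iff.1 (by rw [hc]; exact one_ne_zero)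
  have h1 := hU (σ.symm j)
  rw [σ.apply_symm_apply] at h1
  rw [LinearIsometryEquiv.symm_apply_eq, map_smul, h1, smul_smul, inv_mul_cancel₀ hne, one_smul]

end UnitarilyEquivalent

/-! ### The Heisenberg–Weyl group in dimension three -/

/-- The additive character `x ↦ ω ^ x` of `ℤ / 3`, where `ω = exp (2πi / 3)`. -/
def char3 (x : Fin 3) : ℂ := Complex.exp (2 * Real.pi * Complex.I / 3) ^ (x : ℕ)

theorem char3_one_ne_one : char3 1 ≠ 1 := by
  have h := Complex.isPrimitiveRoot_exp 3 (by norm_num)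
  simpa [char3] using h.ne_one (by norm_num)

theorem exp_pow_three : Complex.exp (2 * Real.pi * Complex.I / 3) ^ 3 = 1 := by
  simpa using (Complex.isPrimitiveRoot_exp 3 (by norm_num)).pow_eq_one

theorem char3_one_pow_three : char3 1 ^ 3 = 1 := by simpa [char3] using exp_pow_three

theorem one_add_char3_add_sq : 1 + char3 1 + char3 1 ^ 2 = 0 := by
  refine (mul_eq_zero.1 (?_ : (char3 1 - 1) * _ = 0)).resolve_left
    (sub_ne_zero.2 char3_one_ne_one)
  linear_combination char3_one_pow_three

@[simp] theorem char3_zero : char3 0 = 1 := by simp [char3]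

theorem char3_two : char3 2 = char3 1 ^ 2 := by simp [char3]

theorem char3_add (x y : Fin 3) : char3 (x + y) = char3 x * char3 y := by
  simp only [char3, ← pow_add, Fin.val_add]
  exact (pow_eq_pow_mod _ exp_pow_three).symm

theorem char3_mul (x y : Fin 3) : char3 (x * y) = char3 x ^ (y : ℕ) := by
  simp only [char3, ← pow_mul, Fin.val_mul]
  exact (pow_eq_pow_mod _ exp_pow_three).symm

@[simp] theorem norm_char3 (x : Fin 3) : ‖char3 x‖ = 1 := by
  have h := Complex.norm_eq_one_of_pow_eq_one char3_one_pow_three (by norm_num)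
  have hx : char3 x = char3 1 ^ (x : ℕ) := by simp [char3]
  rw [hx, norm_pow, h, one_pow]

theorem conj_char3 (x : Fin 3) : starRingEnd ℂ (char3 x) = char3 (-x) := by
  have h1 : char3 x * char3 (-x) = 1 := by
    rw [← char3_add, show x + -x = 0 by decide +revert, char3_zero]
  have h2 : char3 x ≠ 0 := norm_ne_zero_iff.1 (by simp)
  have h3 : char3 x * starRingEnd ℂ (char3 x) = 1 := by
    rw [Complex.mul_conj']
    simp
  exact mul_left_cancel₀ h2 (h3.trans h1.symm)

theorem exists_char3_eq_of_pow_three {z : ℂ} (hz : z ^ 3 = 1) : ∃ p, z = char3 p := by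
  have h : (z - 1) * ((z - char3 1) * (z - char3 1 ^ 2)) = 0 := by
    linear_combination hz + (-z ^ 2 + z) * one_add_char3_add_sq + (z - 1) * char3_one_pow_three
  rcases mul_eq_zero.1 h with h | h
  · exact ⟨0, by rw [char3_zero, sub_eq_zero.1 h]⟩
  rcases mul_eq_zero.1 h with h | h
  · exact ⟨1, sub_eq_zero.1 h⟩
  · exact ⟨2, by rw [char3_two, sub_eq_zero.1 h]⟩

theorem ofLp_toEuclideanLin (M : Matrix (Fin 3) (Fin 3) ℂ) (v : Ket 3) :
    (Matrix.toEuclideanLin M v).ofLp = M.mulVec v.ofLp := rfl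

/-- `(X^{k₁} Z^{k₂} ψ)_i = ω^{k₂ (i - k₁)} ψ_{i - k₁}`. -/
theorem hwOrbit_apply (ψ : Ket 3) (k : Fin 3 × Fin 3) (i : Fin 3) :
    hwOrbit ψ k i = char3 (k.2 * (i - k.1)) * ψ (i - k.1) := by
  obtain ⟨a, b⟩ := k
  have hX : ∀ v : Fin 3 → ℂ, ((shiftX 3) ^ (a : ℕ)).mulVec v = fun i => v (i - a) := by
    have h1 : ∀ v : Fin 3 → ℂ, (shiftX 3).mulVec v = fun i => v (i - 1) := by
      intro v
      ext i
      simp only [Matrix.mulVec, dotProduct, shiftX, Matrix.of_apply, Fin.sum_univ_three]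
      fin_cases i <;> simp
      all_goals rfl
    intro v
    fin_cases a
    · ext i
      simp
    · simp [h1]
    · ext i
      have h2 : ∀ i : Fin 3, i - 1 - 1 = i - 2 := by decide
      simp [pow_two, ← Matrix.mulVec_mulVec, h1, h2]
  have hZ : (clockZ 3) ^ (b : ℕ) = Matrix.diagonal fun k => char3 (b * k) := by
    rw [clockZ, Matrix.diagonal_pow]
    congr 1
    ext k
    rw [show b * k = k * b by decide +revert, char3_mul]
    rfl
  simp only [hwOrbit, ofLp_toEuclideanLin, ← Matrix.mulVec_mulVec, hX, hZ,
    Matrix.mulVec_diagonal]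

/-- A linear isometry of the three-dimensional space onto itself from a matrix preserving norms. -/
def isometryOfMatrix (M : Matrix (Fin 3) (Fin 3) ℂ)
    (hM : ∀ v : Ket 3, ‖Matrix.toEuclideanLin M v‖ = ‖v‖) : Ket 3 ≃ₗᵢ[ℂ] Ket 3 :=
  LinearIsometry.toLinearIsometryEquiv ⟨Matrix.toEuclideanLin M, hM⟩ rfl

theorem isometryOfMatrix_apply (M : Matrix (Fin 3) (Fin 3) ℂ)
    (hM : ∀ v : Ket 3, ‖Matrix.toEuclideanLin M v‖ = ‖v‖) (v : Ket 3) (i : Fin 3) :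
    isometryOfMatrix M hM v i = M.mulVec v.ofLp i := rfl

/-- The unitary operator with the diagonal matrix of the phases `u`. -/
def diagIsometry (u : Fin 3 → ℂ) (hu : ∀ i, ‖u i‖ = 1) : Ket 3 ≃ₗᵢ[ℂ] Ket 3 :=
  isometryOfMatrix (Matrix.diagonal u) fun v => by
    simp [EuclideanSpace.norm_eq, Matrix.mulVec_diagonal, hu]

theorem diagIsometry_apply (u : Fin 3 → ℂ) (hu : ∀ i, ‖u i‖ = 1) (v : Ket 3) (i : Fin 3) :
    diagIsometry u hu v i = u i * v i := by
  rw [diagIsometry, isometryOfMatrix_apply, Matrix.mulVec_diagonal]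

theorem sum_normSq_fourier (x y z : ℂ) :
    ‖x + y + z‖ ^ 2 + ‖x + char3 1 * y + char3 1 ^ 2 * z‖ ^ 2
      + ‖x + char3 1 ^ 2 * y + char3 1 * z‖ ^ 2 = 3 * (‖x‖ ^ 2 + ‖y‖ ^ 2 + ‖z‖ ^ 2) := by
  have hc : starRingEnd ℂ (char3 1) = char3 1 ^ 2 := by
    rw [conj_char3, ← char3_two]
    rfl
  apply Complex.ofReal_injective
  push_cast
  simp only [← Complex.mul_conj', map_add, map_mul, map_pow, hc]
  have h1 := one_add_char3_add_sq
  grind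

/-- The discrete Fourier transform on three points. -/
def fourierIsometry : Ket 3 ≃ₗᵢ[ℂ] Ket 3 :=
  isometryOfMatrix (Matrix.of fun i j => ((1 / Real.sqrt 3 : ℝ) : ℂ) * char3 (i * j)) fun v => by
    rw [EuclideanSpace.norm_eq, EuclideanSpace.norm_eq]
    congr 1
    have h3 : ‖((1 / Real.sqrt 3 : ℝ) : ℂ)‖ ^ 2 = 1 / 3 := by
      rw [Complex.norm_real, Real.norm_eq_abs, sq_abs, div_pow, Real.sq_sqrt (by norm_num), one_pow]
    simp only [ofLp_toEuclideanLin, Matrix.mulVec, dotProduct, Matrix.of_apply,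
      mul_assoc, ← Finset.mul_sum, norm_mul, mul_pow, h3]
    have := sum_normSq_fourier (v 0) (v 1) (v 2)
    rw [← char3_two] at this
    simp [Fin.sum_univ_three, show (2 : Fin 3) * 2 = 1 from rfl] at this ⊢
    linarith

theorem fourierIsometry_apply (v : Ket 3) (i : Fin 3) :
    fourierIsometry v i = ((1 / Real.sqrt 3 : ℝ) : ℂ) * ∑ j, char3 (i * j) * v j := by
  rw [fourierIsometry, isometryOfMatrix_apply, Matrix.mulVec, dotProduct, Finset.mul_sum]
  simp only [Matrix.of_apply, mul_assoc]

/-- The coordinate reflection `i ↦ -i`. -/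
def reflectIsometry : Ket 3 ≃ₗᵢ[ℂ] Ket 3 :=
  LinearIsometryEquiv.piLpCongrLeft 2 ℂ ℂ (Equiv.neg (Fin 3))

theorem reflectIsometry_apply (v : Ket 3) (i : Fin 3) : reflectIsometry v i = v (-i) := rfl

/-! ### Unitary equivalences between Heisenberg–Weyl orbits -/

theorem unitarilyEquivalent_hwOrbit_smul (ψ : Ket 3) {c : ℂ} (hc : ‖c‖ = 1) :
    UnitarilyEquivalent (hwOrbit (c • ψ)) (hwOrbit ψ) :=
  ⟨Equiv.refl _, fun _ => c, fun _ => hc, LinearIsometryEquiv.refl ℂ _, fun k => by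
    simp [hwOrbit, map_smul]⟩

/-- The ket with cyclically permuted coordinates `ψ_{i + j}`. -/
def shiftKet (j : Fin 3) (ψ : Ket 3) : Ket 3 := WithLp.toLp 2 fun i => ψ (i + j)

theorem unitarilyEquivalent_hwOrbit_shiftKet (j : Fin 3) (ψ : Ket 3) :
    UnitarilyEquivalent (hwOrbit (shiftKet j ψ)) (hwOrbit ψ) := by
  refine ⟨(Equiv.subRight j).prodCongr (Equiv.refl _), fun k => char3 (k.2 * -j),
    fun k => norm_char3 _, LinearIsometryEquiv.refl ℂ _, fun ⟨a, b⟩ => ?_⟩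
  ext i
  simp only [LinearIsometryEquiv.coe_refl, id_eq, hwOrbit_apply, shiftKet, PiLp.smul_apply,
    smul_eq_mul, Equiv.prodCongr_apply, Prod.map_apply, Equiv.subRight_apply, Equiv.refl_apply]
  rw [← mul_assoc, ← char3_add]
  refine congrArg₂ _ (congrArg char3 ?_) (congrArg ψ.ofLp ?_) <;> decide +revert

/-- The orbit of `ψ` is unitarily equivalent to the orbit of `D ψ`, where the diagonal operator `D`
has the entries `ω^{α i² + β i}`. Every sequence of three cube roots of unity starting with `1` is
of this form. -/
theorem unitarilyEquivalent_hwOrbit_diag (α β : Fin 3) (ψ : Ket 3) :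
    UnitarilyEquivalent (hwOrbit ψ)
      (hwOrbit (diagIsometry (fun i => char3 (α * i * i + β * i)) (fun _ => norm_char3 _) ψ)) := by
  refine ⟨⟨fun k => (k.1, k.2 + 2 * α * k.1), fun k => (k.1, k.2 - 2 * α * k.1), fun k => ?_,
    fun k => ?_⟩, fun k => char3 (α * k.1 * k.1 + β * k.1),
    fun k => norm_char3 _, diagIsometry (fun i => char3 (α * i * i + β * i)) fun _ => norm_char3 _,
    fun ⟨a, b⟩ => ?_⟩
  · ext1
    · rfl
    · have : ∀ x y : Fin 3, x + y - y = x := by decide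
      exact this _ _
  · ext1
    · rfl
    · have : ∀ x y : Fin 3, x - y + y = x := by decide
      exact this _ _
  ext i
  simp only [hwOrbit_apply, PiLp.smul_apply, smul_eq_mul, Equiv.coe_fn_mk, diagIsometry_apply]
  simp only [← mul_assoc, ← char3_add]
  congr 2
  decide +revert

theorem unitarilyEquivalent_hwOrbit_fourier (ψ : Ket 3) :
    UnitarilyEquivalent (hwOrbit ψ) (hwOrbit (fourierIsometry ψ)) := by
  refine ⟨⟨fun k => (-k.2, k.1), fun k => (k.2, -k.1), fun k => ?_, fun k => ?_⟩,
    fun k => char3 (-(k.1 * k.2)), fun k => norm_char3 _, fourierIsometry, fun ⟨a, b⟩ => ?_⟩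
  · simp
  · simp
  ext i
  simp only [hwOrbit_apply, PiLp.smul_apply, smul_eq_mul, Equiv.coe_fn_mk, fourierIsometry_apply,
    Finset.mul_sum]
  refine Fintype.sum_equiv (Equiv.subRight a) _ _ fun j => ?_
  have h1 : char3 (i * j) * char3 (b * (j - a))
      = char3 (-(a * b)) * char3 (a * (i - -b)) * char3 ((i - -b) * (j - a)) := by
    simp only [← char3_add]
    congr 1
    decide +revert
  simp only [Equiv.subRight_apply]
  linear_combination ((1 / Real.sqrt 3 : ℝ) : ℂ) * ψ (j - a) * h1

theorem unitarilyEquivalent_hwOrbit_reflect (ψ : Ket 3) :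
    UnitarilyEquivalent (hwOrbit ψ) (hwOrbit (reflectIsometry ψ)) := by
  refine ⟨(Equiv.neg _).prodCongr (Equiv.neg _), fun _ => 1, fun _ => norm_one, reflectIsometry,
    fun ⟨a, b⟩ => ?_⟩
  ext i
  simp only [hwOrbit_apply, PiLp.smul_apply, smul_eq_mul, reflectIsometry_apply, one_mul,
    Equiv.prodCongr_apply, Prod.map_apply, Equiv.neg_apply]
  refine congrArg₂ _ (congrArg char3 ?_) (congrArg ψ.ofLp ?_) <;> decide +revert

/-! ### The fiducial kets `(e_1 - e^{it} e_2) / √2` -/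

theorem fiducial3_zero (t : ℝ) : fiducial3 t 0 = 0 := by simp [fiducial3]

theorem fiducial3_one (t : ℝ) : fiducial3 t 1 = ((1 / Real.sqrt 2 : ℝ) : ℂ) := by simp [fiducial3]

theorem fiducial3_two (t : ℝ) :
    fiducial3 t 2 = -((1 / Real.sqrt 2 : ℝ) : ℂ) * Complex.exp (Complex.I * t) := by
  simp [fiducial3]

theorem normSq_inv_sqrt_two : ‖((1 / Real.sqrt 2 : ℝ) : ℂ)‖ ^ 2 = 1 / 2 := by
  rw [Complex.norm_real, Real.norm_eq_abs, sq_abs, div_pow, Real.sq_sqrt (by norm_num), one_pow]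

/-- A ket with `ψ_0 = 0` and `|ψ_1|² = |ψ_2|² = 1 / 2` is some `fiducial3 t` up to a phase. -/
theorem exists_unitarilyEquivalent_fiducial3_of_zero {ψ : Ket 3} (h0 : ψ 0 = 0)
    (h1 : ‖ψ 1‖ ^ 2 = 1 / 2) (h2 : ‖ψ 2‖ ^ 2 = 1 / 2) :
    ∃ t : ℝ, UnitarilyEquivalent (hwOrbit ψ) (hwOrbit (fiducial3 t)) := by
  have hs : ∀ z : ℂ, ‖z‖ ^ 2 = 1 / 2 → ‖z‖ = 1 / Real.sqrt 2 := by
    intro z hz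
    rw [← Real.sqrt_sq (norm_nonneg z), hz, Real.sqrt_div (by norm_num), Real.sqrt_one]
  have e1 := Complex.norm_mul_exp_arg_mul_I (ψ 1)
  have e2 := Complex.norm_mul_exp_arg_mul_I (ψ 2)
  rw [hs _ h1] at e1
  rw [hs _ h2] at e2
  refine ⟨(ψ 2).arg - (ψ 1).arg + Real.pi, ?_⟩
  convert unitarilyEquivalent_hwOrbit_smul (fiducial3 ((ψ 2).arg - (ψ 1).arg + Real.pi))
    (Complex.norm_exp_ofReal_mul_I (ψ 1).arg) using 2
  ext i
  fin_cases i
  · simp [h0, fiducial3_zero]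
  · simp only [Fin.mk_one, PiLp.smul_apply, fiducial3_one, smul_eq_mul]
    rw [mul_comm, e1]
  · simp only [Fin.reduceFinMk, PiLp.smul_apply, fiducial3_two, smul_eq_mul]
    have h3 : Complex.exp (Complex.I * (((ψ 2).arg - (ψ 1).arg + Real.pi : ℝ) : ℂ))
        = -(Complex.exp ((ψ 2).arg * Complex.I) * (Complex.exp ((ψ 1).arg * Complex.I))⁻¹) := by
      rw [← Complex.exp_neg, ← Complex.exp_add, ← neg_one_mul, ← Complex.exp_pi_mul_I,
        ← Complex.exp_add]
      congr 1
      push_cast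
      ring
    have h4 := Complex.exp_ne_zero ((ψ 1).arg * Complex.I)
    rw [h3]
    conv_lhs => rw [← e2]
    field_simp

/-- The diagonal operator with entries `1, ζ, ζ²`, `ζ⁹ = 1`, multiplies the relative phase of all the
kets in the orbit by `ζ`, up to cube roots of unity. -/
theorem unitarilyEquivalent_fiducial3_of_pow_nine {s t : ℝ} {ζ : ℂ} (hζ : ζ ^ 9 = 1)
    (hst : Complex.exp (Complex.I * s) = ζ * Complex.exp (Complex.I * t)) :
    UnitarilyEquivalent (hwOrbit (fiducial3 t)) (hwOrbit (fiducial3 s)) := by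
  have hn : ‖ζ‖ = 1 := Complex.norm_eq_one_of_pow_eq_one hζ (by norm_num)
  obtain ⟨m, hm⟩ := exists_char3_eq_of_pow_three (z := ζ ^ 3) (by rw [← pow_mul]; exact hζ)
  set h : Fin 3 → Fin 3 := ![0, -m, 0] with hh
  refine ⟨⟨fun k => (k.1, k.2 + h k.1), fun k => (k.1, k.2 - h k.1), fun k => ?_,
    fun k => ?_⟩, fun k => ζ ^ ((k.1 + 1 : Fin 3) : ℕ) * char3 (-h k.1), fun k => by simp [hn],
    diagIsometry (fun i => ζ ^ (i : ℕ)) (fun i => by simp [hn]), fun ⟨a, b⟩ => ?_⟩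
  · ext1
    · rfl
    · have : ∀ x y : Fin 3, x + y - y = x := by decide
      exact this _ _
  · ext1
    · rfl
    · have : ∀ x y : Fin 3, x - y + y = x := by decide
      exact this _ _
  have c1 : char3 (-h a) * char3 (b + h a) = char3 b := by
    rw [← char3_add]
    exact congrArg _ ((by decide : ∀ y b : Fin 3, -y + (b + y) = b) _ _)
  have c2 : char3 (-h a) * char3 ((b + h a) * 2) = char3 (b * 2) * char3 (h a) := by
    rw [← char3_add, ← char3_add]
    exact congrArg _ ((by decide : ∀ y b : Fin 3, -y + (b + y) * 2 = b * 2 + y) _ _)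
  have c3 : ζ ^ ((a + 1 : Fin 3) : ℕ) * char3 (h a) * ζ = ζ ^ ((a + 2 : Fin 3) : ℕ) := by
    fin_cases a
    · simp [hh, pow_two]
    · have h1 : char3 (-m) * char3 m = 1 := by
        rw [← char3_add, (by decide : ∀ y : Fin 3, -y + y = 0), char3_zero]
      simp only [hh, Fin.mk_one, Matrix.cons_val_one, Matrix.cons_val_zero]
      change ζ ^ 2 * char3 (-m) * ζ = ζ ^ 0
      linear_combination char3 (-m) * hm + h1
    · simp [hh]
  have key : ∀ x : Fin 3, ζ ^ ((a + x : Fin 3) : ℕ) * (char3 (b * x) * fiducial3 t x)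
      = ζ ^ ((a + 1 : Fin 3) : ℕ) * char3 (-h a) * (char3 ((b + h a) * x) * fiducial3 s x) := by
    intro x
    fin_cases x
    · simp [fiducial3_zero]
    · simp only [Fin.mk_one, fiducial3_one, show ∀ y : Fin 3, y * 1 = y by decide]
      linear_combination -ζ ^ ((a + 1 : Fin 3) : ℕ) * ((1 / Real.sqrt 2 : ℝ) : ℂ) * c1
    · simp only [Fin.reduceFinMk, fiducial3_two, hst]
      linear_combination ζ ^ ((a + 1 : Fin 3) : ℕ) * ((1 / Real.sqrt 2 : ℝ) : ℂ) * ζ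
        * Complex.exp (Complex.I * t) * c2 + ((1 / Real.sqrt 2 : ℝ) : ℂ) *
        Complex.exp (Complex.I * t) * char3 (b * 2) * c3
  ext i
  simp only [hwOrbit_apply, PiLp.smul_apply, smul_eq_mul, Equiv.coe_fn_mk, diagIsometry_apply]
  convert key (i - a) using 3
  exact congrArg Fin.val ((by decide : ∀ i a : Fin 3, i = a + (i - a)) i a)

theorem unitarilyEquivalent_fiducial3_neg (t : ℝ) :
    UnitarilyEquivalent (hwOrbit (fiducial3 t)) (hwOrbit (fiducial3 (-t))) := by
  have h : reflectIsometry (fiducial3 t)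
      = (-Complex.exp (Complex.I * t)) • fiducial3 (-t) := by
    ext i
    rw [reflectIsometry_apply]
    fin_cases i
    · simp [fiducial3_zero]
    · change fiducial3 t 2 = _ * fiducial3 (-t) 1
      rw [fiducial3_one, fiducial3_two]
      ring
    · change fiducial3 t 1 = _ * fiducial3 (-t) 2
      have : Complex.exp (Complex.I * t) * Complex.exp (Complex.I * (-t : ℝ)) = 1 := by
        rw [← Complex.exp_add]
        simp
      rw [fiducial3_one, fiducial3_two]
      linear_combination -((1 / Real.sqrt 2 : ℝ) : ℂ) * this
  have h1 := unitarilyEquivalent_hwOrbit_reflect (fiducial3 t)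
  rw [h] at h1
  exact h1.trans (unitarilyEquivalent_hwOrbit_smul _ (by
    rw [norm_neg, mul_comm, Complex.norm_exp_ofReal_mul_I]))

theorem unitarilyEquivalent_fiducial3_of_cos_eq {s t : ℝ}
    (h : Real.cos (9 * t) = Real.cos (9 * s)) :
    UnitarilyEquivalent (hwOrbit (fiducial3 t)) (hwOrbit (fiducial3 s)) := by
  have hshift : ∀ (k : ℤ) (u : ℝ), 9 * s = 2 * k * Real.pi + 9 * u →
      UnitarilyEquivalent (hwOrbit (fiducial3 u)) (hwOrbit (fiducial3 s)) := by
    intro k u hu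
    refine unitarilyEquivalent_fiducial3_of_pow_nine
      (ζ := Complex.exp (k * (2 * Real.pi * Complex.I) / 9)) ?_ ?_
    · rw [← Complex.exp_nat_mul, ← Complex.exp_int_mul_two_pi_mul_I k]
      congr 1
      push_cast
      ring
    · rw [← Complex.exp_add]
      congr 1
      have : s = 2 * k * Real.pi / 9 + u := by linarith
      rw [this]
      push_cast
      ring
  obtain ⟨k, hk | hk⟩ := Real.cos_eq_cos_iff.1 h
  · exact hshift k t hk
  · exact (unitarilyEquivalent_fiducial3_neg t).trans (hshift k (-t) (by linarith))

/-! ### The SIC POVM, the permanent and the entanglement for `(e_1 - e^{it} e_2) / √2` -/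

theorem conj_char3_one : starRingEnd ℂ (char3 1) = char3 1 ^ 2 := by
  rw [conj_char3, ← char3_two]
  rfl

/-- The squared overlaps of a ket with the orbit of `fiducial3 t`. -/
theorem normSq_inner_hwOrbit_fiducial3 (t : ℝ) (v : Ket 3) (a b : Fin 3) :
    ‖⟪v, hwOrbit (fiducial3 t) (a, b)⟫_ℂ‖ ^ 2 = 1 / 2 *
      ‖starRingEnd ℂ (v (a + 1)) - char3 b
        * (Complex.exp (Complex.I * t) * starRingEnd ℂ (v (a + 2)))‖ ^ 2 := by
  have h1 : ⟪v, hwOrbit (fiducial3 t) (a, b)⟫_ℂ = (char3 b * ((1 / Real.sqrt 2 : ℝ) : ℂ)) *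
      (starRingEnd ℂ (v (a + 1)) - char3 b
        * (Complex.exp (Complex.I * t) * starRingEnd ℂ (v (a + 2)))) := by
    have h2 : char3 (b * 2) = char3 b * char3 b := by
      rw [← char3_add]
      exact congrArg _ ((by decide : ∀ b : Fin 3, b * 2 = b + b) b)
    rw [PiLp.inner_apply, ← Equiv.sum_comp (Equiv.addLeft a), Fin.sum_univ_three]
    simp only [RCLike.inner_apply, Equiv.coe_addLeft, hwOrbit_apply,
      (by decide : ∀ a x : Fin 3, a + x - a = x), fiducial3_zero, fiducial3_one, fiducial3_two,
      (by decide : ∀ b : Fin 3, b * 1 = b), h2]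
    ring
  rw [h1, norm_mul, norm_mul, mul_pow, mul_pow, normSq_inv_sqrt_two, norm_char3]
  ring

theorem sum_normSq_sub_char3_mul (x y : ℂ) :
    ∑ b, ‖x - char3 b * y‖ ^ 2 = 3 * (‖x‖ ^ 2 + ‖y‖ ^ 2) := by
  apply Complex.ofReal_injective
  push_cast
  simp only [Fin.sum_univ_three, ← Complex.mul_conj', map_sub, map_mul, map_pow, char3_zero,
    char3_two, conj_char3_one, map_one]
  have h1 := one_add_char3_add_sq
  grind

theorem sum_normSq_sq_sub_char3_mul (x y : ℂ) :
    ∑ b, (‖x - char3 b * y‖ ^ 2) ^ 2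
      = 3 * (‖x‖ ^ 2 + ‖y‖ ^ 2) ^ 2 + 6 * ‖x‖ ^ 2 * ‖y‖ ^ 2 := by
  apply Complex.ofReal_injective
  push_cast
  simp only [Fin.sum_univ_three, ← Complex.mul_conj', map_sub, map_mul, map_pow, char3_zero,
    char3_two, conj_char3_one, map_one]
  have h1 := one_add_char3_add_sq
  grind

theorem norm_exp_I_mul (t : ℝ) : ‖Complex.exp (Complex.I * t)‖ = 1 := by
  rw [mul_comm, Complex.norm_exp_ofReal_mul_I]

/-- The squared overlaps of a unit vector with the nine kets sum up to `3`. -/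
theorem sum_normSq_inner_hwOrbit_fiducial3 (t : ℝ) {v : Ket 3} (hv : ‖v‖ = 1) :
    ∑ k, ‖⟪v, hwOrbit (fiducial3 t) k⟫_ℂ‖ ^ 2 = 3 := by
  have hv' := EuclideanSpace.norm_sq_eq v
  rw [hv, Fin.sum_univ_three] at hv'
  simp only [Fintype.sum_prod_type, normSq_inner_hwOrbit_fiducial3, ← Finset.mul_sum,
    sum_normSq_sub_char3_mul, norm_mul, norm_exp_I_mul, RCLike.norm_conj]
  rw [Fin.sum_univ_three]
  simp only [show (0 : Fin 3) + 1 = 1 from rfl, show (0 : Fin 3) + 2 = 2 from rfl,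
    show (1 : Fin 3) + 1 = 2 from rfl, show (1 : Fin 3) + 2 = 0 from rfl,
    show (2 : Fin 3) + 1 = 0 from rfl, show (2 : Fin 3) + 2 = 1 from rfl]
  linarith

/-- The fourth powers of the overlaps of a unit vector with the nine kets sum up to `3 / 2`. -/
theorem sum_normSq_sq_inner_hwOrbit_fiducial3 (t : ℝ) {v : Ket 3} (hv : ‖v‖ = 1) :
    ∑ k, (‖⟪v, hwOrbit (fiducial3 t) k⟫_ℂ‖ ^ 2) ^ 2 = 3 / 2 := by
  have hv' := EuclideanSpace.norm_sq_eq v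
  rw [hv, Fin.sum_univ_three] at hv'
  simp only [Fintype.sum_prod_type, normSq_inner_hwOrbit_fiducial3, mul_pow (1 / 2 : ℝ),
    ← Finset.mul_sum, sum_normSq_sq_sub_char3_mul, norm_mul, norm_exp_I_mul, RCLike.norm_conj]
  rw [Fin.sum_univ_three]
  simp only [show (0 : Fin 3) + 1 = 1 from rfl, show (0 : Fin 3) + 2 = 2 from rfl,
    show (1 : Fin 3) + 1 = 2 from rfl, show (1 : Fin 3) + 2 = 0 from rfl,
    show (2 : Fin 3) + 1 = 0 from rfl, show (2 : Fin 3) + 2 = 1 from rfl]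
  linear_combination (-3 / 2) * (1 + (‖v 0‖ ^ 2 + ‖v 1‖ ^ 2 + ‖v 2‖ ^ 2)) * hv'

theorem isSIC_fiducial3 (t : ℝ) : IsSIC (hwOrbit (fiducial3 t)) := by
  refine ⟨rfl, ?_⟩
  rintro ⟨a, b⟩ ⟨a', b'⟩
  rw [normSq_inner_hwOrbit_fiducial3]
  have hs := normSq_inv_sqrt_two
  have hs' : ‖-((1 / Real.sqrt 2 : ℝ) : ℂ)‖ ^ 2 = 1 / 2 := by rw [norm_neg, hs]
  simp only [hwOrbit_apply]
  obtain rfl | rfl | rfl : a' = a ∨ a' = a + 1 ∨ a' = a + 2 := by decide +revert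
  · simp only [(by decide : ∀ a x : Fin 3, a + x - a = x), fiducial3_one, fiducial3_two, map_mul,
      Complex.conj_ofReal, map_neg, conj_char3, Prod.mk.injEq, true_and]
    have he : Complex.exp (Complex.I * t) * starRingEnd ℂ (Complex.exp (Complex.I * t)) = 1 := by
      rw [Complex.mul_conj', norm_exp_I_mul]
      norm_num
    have h1 : char3 (-(b * 1)) * ((1 / Real.sqrt 2 : ℝ) : ℂ) - char3 b' *
        (Complex.exp (Complex.I * t) * (char3 (-(b * 2)) * (-((1 / Real.sqrt 2 : ℝ) : ℂ) *
        starRingEnd ℂ (Complex.exp (Complex.I * t)))))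
        = char3 (-(b * 1)) * ((1 / Real.sqrt 2 : ℝ) : ℂ) * (1 + char3 (b' - b)) := by
      have h2 : char3 b' * char3 (-(b * 2)) = char3 (-(b * 1)) * char3 (b' - b) := by
        rw [← char3_add, ← char3_add]
        exact congrArg _ ((by decide : ∀ b b' : Fin 3, b' + -(b * 2) = -(b * 1) + (b' - b)) b b')
      linear_combination ((1 / Real.sqrt 2 : ℝ) : ℂ) * char3 b' * char3 (-(b * 2)) * he
        + ((1 / Real.sqrt 2 : ℝ) : ℂ) * h2
    rw [h1, norm_mul, norm_mul, mul_pow, mul_pow, hs, norm_char3]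
    split_ifs with h
    · subst h
      rw [(by decide : ∀ b : Fin 3, b - b = 0), char3_zero]
      norm_num
    · have h3 := (by decide : ∀ b b' : Fin 3, b ≠ b' → b' - b = 1 ∨ b' - b = 2) b b' h
      have h4 := one_add_char3_add_sq
      have h5 : ‖1 + char3 (b' - b)‖ = 1 := by
        rcases h3 with h3 | h3
        · rw [h3, show 1 + char3 1 = -char3 2 by rw [char3_two]; linear_combination h4, norm_neg,
            norm_char3]
        · rw [h3, show 1 + char3 2 = -char3 1 by rw [char3_two]; linear_combination h4, norm_neg,
            norm_char3]
      rw [h5]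
      norm_num
  · have hne : ¬ ((a, b) = (a + 1, b')) := by
      simp only [Prod.mk.injEq, not_and]
      decide +revert
    simp only [(by decide : ∀ a : Fin 3, a + 1 + 1 - a = 2),
      (by decide : ∀ a : Fin 3, a + 1 + 2 - a = 0), fiducial3_zero, fiducial3_two, map_mul,
      map_zero, mul_zero, sub_zero, norm_mul, RCLike.norm_conj, norm_char3, norm_exp_I_mul,
      mul_pow, hs', if_neg hne]
    norm_num
  · have hne : ¬ ((a, b) = (a + 2, b')) := by
      simp only [Prod.mk.injEq, not_and]
      decide +revert
    simp only [(by decide : ∀ a : Fin 3, a + 2 + 1 - a = 0),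
      (by decide : ∀ a : Fin 3, a + 2 + 2 - a = 1), fiducial3_zero, fiducial3_one, map_mul,
      map_zero, mul_zero, zero_sub, norm_neg, norm_mul, RCLike.norm_conj, norm_char3,
      norm_exp_I_mul, mul_pow, hs, if_neg hne]
    norm_num

theorem hwOrbit_zero (ψ : Ket 3) : hwOrbit ψ (0, 0) = ψ := by
  ext i
  simp [hwOrbit_apply]

theorem norm_eq_one_of_isSIC {ψ : Ket 3} (h : IsSIC (hwOrbit ψ)) (k : Fin 3 × Fin 3) :
    ‖hwOrbit ψ k‖ = 1 := by
  have h1 := h.2 k k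
  rw [inner_self_eq_norm_sq_to_K] at h1
  norm_num at h1
  rcases h1 with (h1 | h1) | h1
  · exact h1
  · linarith [norm_nonneg (hwOrbit ψ k)]
  · linarith [sq_nonneg ‖hwOrbit ψ k‖]

theorem isFiducial_of_isSIC {ψ : Ket 3} (h : IsSIC (hwOrbit ψ)) : IsFiducial ψ := by
  refine ⟨by simpa [hwOrbit_zero] using norm_eq_one_of_isSIC h (0, 0), fun k hk => ?_⟩
  have h1 := h.2 (0, 0) k
  rw [hwOrbit_zero, if_neg hk.symm] at h1
  rw [← Real.sqrt_sq (norm_nonneg ⟪ψ, hwOrbit ψ k⟫_ℂ), h1, Real.sqrt_div (by norm_num)]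
  simp

theorem prod_normSq_inner_of_isSIC {ψ : Fin 3 × Fin 3 → Ket 3} (h : IsSIC ψ)
    (k : Fin 3 × Fin 3) : (∏ j, ‖⟪ψ k, ψ j⟫_ℂ‖) ^ 2 = 1 / 4 ^ 8 := by
  rw [← Finset.prod_pow, Finset.prod_congr rfl fun j _ => h.2 k j,
    ← Finset.mul_prod_erase _ _ (Finset.mem_univ k), Finset.prod_congr rfl (g := fun _ => 1 / 4)]
  · simp
    norm_num
  · intro j hj
    rw [if_neg (Finset.ne_of_mem_erase hj).symm]
    norm_num

/-- With `s = e^{3it}`, the product of the nine linear forms of the orbit of `fiducial3 t` is the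
product of the `X_i³ - s X_{i+1}³`, up to a constant. -/
theorem formProd_hwOrbit_fiducial3 (t : ℝ) :
    formProd (hwOrbit (fiducial3 t)) = MvPolynomial.C (((1 / Real.sqrt 2 : ℝ) : ℂ) ^ 9) *
      ∏ a : Fin 3, (MvPolynomial.X (a + 1) ^ 3
        - MvPolynomial.C (Complex.exp (Complex.I * t) ^ 3) * MvPolynomial.X (a + 2) ^ 3) := by
  set r : ℂ := ((1 / Real.sqrt 2 : ℝ) : ℂ) with hr
  set τ : ℂ := Complex.exp (Complex.I * t) with hτ
  have h1 : ∀ a b : Fin 3, ∑ i, MvPolynomial.C (hwOrbit (fiducial3 t) (a, b) i)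
      * (MvPolynomial.X i : MvPolynomial (Fin 3) ℂ)
      = MvPolynomial.C r * (MvPolynomial.C (char3 b) * MvPolynomial.X (a + 1)
        - MvPolynomial.C (char3 b) ^ 2 * (MvPolynomial.C τ * MvPolynomial.X (a + 2))) := by
    intro a b
    have h2 : char3 (b * 2) = char3 b ^ 2 := char3_mul b 2
    rw [← Equiv.sum_comp (Equiv.addLeft a), Fin.sum_univ_three]
    simp only [Equiv.coe_addLeft, hwOrbit_apply, (by decide : ∀ a x : Fin 3, a + x - a = x),
      fiducial3_zero, fiducial3_one, fiducial3_two, (by decide : ∀ b : Fin 3, b * 1 = b), h2,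
      ← hr, ← hτ, map_mul, map_neg, map_pow, map_zero]
    ring
  have h3 : ∀ x y : MvPolynomial (Fin 3) ℂ, ∏ b : Fin 3, (MvPolynomial.C r *
      (MvPolynomial.C (char3 b) * x - MvPolynomial.C (char3 b) ^ 2 * y))
      = MvPolynomial.C r ^ 3 * (x ^ 3 - y ^ 3) := by
    intro x y
    have h4 : (1 : MvPolynomial (Fin 3) ℂ) + MvPolynomial.C (char3 1)
        + MvPolynomial.C (char3 1) ^ 2 = 0 := by
      simpa using congrArg (MvPolynomial.C (σ := Fin 3)) one_add_char3_add_sq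
    rw [Fin.prod_univ_three, char3_two, map_pow, char3_zero, map_one]
    generalize MvPolynomial.C (σ := Fin 3) (char3 1) = w at h4
    grind
  rw [formProd, Fintype.prod_prod_type]
  simp only [h1, h3]
  rw [Finset.prod_mul_distrib, Finset.prod_const, Finset.card_univ, Fintype.card_fin]
  simp only [map_pow, ← pow_mul, mul_pow]

theorem permanent_gram_fiducial3 (t : ℝ) :
    (Matrix.gram ℂ (hwOrbit (fiducial3 t))).permanent
      = ((27 / 32 * (61 - Real.cos (9 * t)) : ℝ) : ℂ) := by
  set r : ℂ := ((1 / Real.sqrt 2 : ℝ) : ℂ) with hr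
  set s : ℂ := Complex.exp (Complex.I * t) ^ 3 with hs
  have hs1 : ‖s‖ = 1 := by rw [hs, norm_pow, norm_exp_I_mul, one_pow]
  have hs3 : ‖1 - s ^ 3‖ ^ 2 = 2 - 2 * Real.cos (9 * t) := by
    have h1 : s ^ 3 = Real.cos (9 * t) + Real.sin (9 * t) * Complex.I := by
      rw [hs, ← pow_mul, ← Complex.exp_nat_mul, Complex.ofReal_cos, Complex.ofReal_sin,
        ← Complex.exp_mul_I]
      congr 1
      push_cast
      ring
    rw [h1, Complex.sq_norm, Complex.normSq_apply]
    simp only [Complex.sub_re, Complex.sub_im, Complex.add_re, Complex.add_im, Complex.mul_re,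
      Complex.mul_im, Complex.one_re, Complex.one_im, Complex.ofReal_re, Complex.ofReal_im,
      Complex.I_re, Complex.I_im]
    linear_combination Real.sin_sq_add_cos_sq (9 * t)
  have hr1 : ‖r ^ 9‖ ^ 2 = 1 / 512 := by
    rw [norm_pow, ← pow_mul, mul_comm, pow_mul, hr, normSq_inv_sqrt_two]
    norm_num
  -- The exponents and the coefficients of the seven monomials of the product.
  set α : Fin 7 → Fin 3 →₀ ℕ := fun i => Finsupp.equivFunOnFinite.symm
    (![![3, 3, 3], ![0, 6, 3], ![6, 3, 0], ![3, 0, 6], ![3, 6, 0], ![0, 3, 6], ![6, 0, 3]] i)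
    with hα
  have hinj : Function.Injective α :=
    Finsupp.equivFunOnFinite.symm.injective.comp (by decide)
  rw [permanent_gram_of_formProd_eq _ α hinj ![r ^ 9 * (1 - s ^ 3), r ^ 9 * -s, r ^ 9 * -s,
    r ^ 9 * -s, r ^ 9 * s ^ 2, r ^ 9 * s ^ 2, r ^ 9 * s ^ 2]]
  · congr 1
    simp only [hα, Fin.sum_univ_succ, Fin.prod_univ_three, Finsupp.equivFunOnFinite_symm_apply_apply]
    simp [mul_pow, hs1, hs3]
    simp only [norm_pow] at hr1
    simp only [hr1, Nat.factorial]
    ring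
  · rw [formProd_hwOrbit_fiducial3]
    simp only [MvPolynomial.monomial_eq, Finsupp.prod_fintype _ _ fun _ => pow_zero _, hα,
      Fin.prod_univ_three, Finsupp.equivFunOnFinite_symm_apply_apply, ← hr, ← hs]
    simp [Fin.sum_univ_succ, show (1 : Fin 3) + 1 = 2 from rfl, show (1 : Fin 3) + 2 = 0 from rfl,
      show (2 : Fin 3) + 1 = 0 from rfl, show (2 : Fin 3) + 2 = 1 from rfl]
    ring

theorem sixty_one_sub_cos_pos (x : ℝ) : 0 < 61 - Real.cos x := by linarith [Real.cos_le_one x]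

theorem geometricMeasure_fiducial3 (t : ℝ) :
    geometricMeasure (symState (hwOrbit (fiducial3 t)))
      = Real.logb 2 (16 * (61 - Real.cos (9 * t)) / 105) := by
  set ψ := hwOrbit (fiducial3 t) with hψ
  have hsic : IsSIC ψ := isSIC_fiducial3 t
  have hcos := sixty_one_sub_cos_pos (9 * t)
  have hperm : (Matrix.gram ℂ ψ).permanent.re = 27 / 32 * (61 - Real.cos (9 * t)) := by
    rw [hψ, permanent_gram_fiducial3, Complex.ofReal_re]
  have hnorm : ∀ k, ‖ψ k‖ = 1 := norm_eq_one_of_isSIC hsic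
  have hmax : ∀ w : Ket 3, ‖w‖ = 1 → ∏ j, ‖⟪w, ψ j⟫_ℂ‖ ≤ ∏ j, ‖⟪ψ (0, 0), ψ j⟫_ℂ‖ := by
    intro w hw
    refine (pow_le_pow_iff_left₀ (by positivity) (by positivity) two_ne_zero).1 ?_
    rw [prod_normSq_inner_of_isSIC hsic, ← Finset.prod_pow]
    refine prod_le_of_sum_of_sum_sq rfl _ (fun _ => by positivity) (fun j => ?_)
      (sum_normSq_inner_hwOrbit_fiducial3 t hw) (sum_normSq_sq_inner_hwOrbit_fiducial3 t hw)
    have := norm_inner_le_norm (𝕜 := ℂ) w (ψ j)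
    rw [hw, hnorm, one_mul] at this
    exact pow_le_one₀ (norm_nonneg _) this
  rw [geometricMeasure, maxOverlapSq_symState ψ (by rw [hperm]; positivity) (hnorm (0, 0)) hmax,
    prod_normSq_inner_of_isSIC hsic, hperm, Real.logb, Real.log_sqrt (by positivity)]
  have h1 : (16 * (61 - Real.cos (9 * t)) / 105) = (((Fintype.card (Fin 3 × Fin 3)).factorial : ℝ)
      / (27 / 32 * (61 - Real.cos (9 * t))) * (1 / 4 ^ 8))⁻¹ := by
    simp [Nat.factorial]
    field_simp
    norm_num
  rw [h1, Real.logb_inv, Real.logb]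
  ring

/-! ### The classification of the fiducial states in dimension three -/

/-- The conditions on the coordinates of a fiducial state that the classification uses; they are
invariant under cyclic permutations. With `∑ |ψ_i|² = 1`, the second condition is
`|⟨ψ|Z|ψ⟩| = 1 / 2`; the third one expresses that `|⟨ψ|X Z^k|ψ⟩|` does not depend on `k`. -/
structure FiducialCoords (x y z : ℂ) : Prop where
  sum_sq : ‖x‖ ^ 2 + ‖y‖ ^ 2 + ‖z‖ ^ 2 = 1
  sum_mul : ‖x‖ ^ 2 * ‖y‖ ^ 2 + ‖y‖ ^ 2 * ‖z‖ ^ 2 + ‖z‖ ^ 2 * ‖x‖ ^ 2 = 1 / 4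
  cyclic : x * z * starRingEnd ℂ y ^ 2 + y * x * starRingEnd ℂ z ^ 2
    + z * y * starRingEnd ℂ x ^ 2 = 0

theorem FiducialCoords.rotate {x y z : ℂ} (h : FiducialCoords x y z) : FiducialCoords y z x :=
  ⟨by linear_combination h.sum_sq, by linear_combination h.sum_mul,
    by linear_combination h.cyclic⟩

theorem IsFiducial.fiducialCoords {ψ : Ket 3} (h : IsFiducial ψ) :
    FiducialCoords (ψ 0) (ψ 1) (ψ 2) := by
  obtain ⟨hn, hk⟩ := h
  have hn' := EuclideanSpace.norm_sq_eq ψ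
  rw [hn, Fin.sum_univ_three] at hn'
  have hov : ∀ k : Fin 3 × Fin 3, k ≠ (0, 0) →
      ⟪ψ, hwOrbit ψ k⟫_ℂ * starRingEnd ℂ ⟪ψ, hwOrbit ψ k⟫_ℂ = 1 / 4 := by
    intro k hk0
    rw [Complex.mul_conj', hk k hk0, show ((3 : ℕ) : ℝ) + 1 = 2 ^ 2 by norm_num,
      Real.sqrt_sq (by norm_num)]
    norm_num
  have hc := conj_char3_one
  have h1 := one_add_char3_add_sq
  have h3 := char3_one_pow_three
  refine ⟨by linarith, ?_, ?_⟩
  · -- With `∑ |ψ_i|² = 1`, the overlap `|⟨ψ|Z|ψ⟩|²` is `1 - 3 ∑_{i<j} |ψ_i|² |ψ_j|²`.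
    have h4 := hov (0, 1) (by decide)
    have hn2 : ψ 0 * starRingEnd ℂ (ψ 0) + ψ 1 * starRingEnd ℂ (ψ 1)
        + ψ 2 * starRingEnd ℂ (ψ 2) = 1 := by
      simp only [Complex.mul_conj']
      exact_mod_cast hn'.symm.trans (by norm_num)
    apply Complex.ofReal_injective
    push_cast
    simp only [PiLp.inner_apply, RCLike.inner_apply, hwOrbit_apply, Fin.sum_univ_three] at h4
    simp [char3_two, hc] at h4
    simp only [← Complex.mul_conj']
    have halg : ∀ a b c w : ℂ, 1 + w + w ^ 2 = 0 → a + b + c = 1 →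
        (a + w * b + w ^ 2 * c) * (a + w ^ 2 * b + w * c) = 1 / 4 →
        a * b + b * c + c * a = 1 / 4 := by
      intro a b c w hw hs hp
      linear_combination (1 / 3) * (a + b + c + 1) * hs - (1 / 3) * hp
        + (1 / 3) * ((b ^ 2 + c ^ 2) * (w - 1) + a * b + a * c + b * c * (w ^ 2 - w + 1)) * hw
    refine halg _ _ _ _ h1 hn2 ?_
    linear_combination h4 - (ψ 0 * starRingEnd ℂ (ψ 0) + char3 1 * (ψ 1 * starRingEnd ℂ (ψ 1))
      + char3 1 ^ 2 * (ψ 2 * starRingEnd ℂ (ψ 2))) * char3 1 * (ψ 2 * starRingEnd ℂ (ψ 2)) * h3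
  · -- The cyclic sum is a third of the sum over `k` of `ω^k |⟨ψ|X Z^k|ψ⟩|² = ω^k / 4`, which vanishes.
    have h40 := hov (1, 0) (by decide)
    have h41 := hov (1, 1) (by decide)
    have h42 := hov (1, 2) (by decide)
    simp only [PiLp.inner_apply, RCLike.inner_apply, hwOrbit_apply, Fin.sum_univ_three,
      show (0 : Fin 3) - 1 = 2 from rfl, show (1 : Fin 3) - 1 = 0 from rfl,
      show (2 : Fin 3) - 1 = 1 from rfl, show (2 : Fin 3) * 2 = 1 from rfl, one_mul, zero_mul,
      mul_one, mul_zero, char3_zero, char3_two, map_add, map_mul, map_pow, hc,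
      Complex.conj_conj] at h40 h41 h42
    grind

/-- The moduli of the coordinates of a fiducial state are the sides of a degenerate triangle. -/
theorem FiducialCoords.degenerate {x y z : ℂ} (h : FiducialCoords x y z) :
    ‖z‖ = ‖x‖ + ‖y‖ ∨ ‖x‖ = ‖y‖ + ‖z‖ ∨ ‖y‖ = ‖z‖ + ‖x‖ := by
  have h1 : (‖x‖ + ‖y‖ + ‖z‖) * ((‖x‖ + ‖y‖ - ‖z‖) * ((‖y‖ + ‖z‖ - ‖x‖) * (‖z‖ + ‖x‖ - ‖y‖)))
      = 0 := by
    linear_combination 4 * h.sum_mul - (‖x‖ ^ 2 + ‖y‖ ^ 2 + ‖z‖ ^ 2 + 1) * h.sum_sq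
  have h2 : ‖x‖ + ‖y‖ + ‖z‖ ≠ 0 := by
    intro h0
    have hx : ‖x‖ = 0 := by linarith [norm_nonneg x, norm_nonneg y, norm_nonneg z]
    have hy : ‖y‖ = 0 := by linarith [norm_nonneg x, norm_nonneg y, norm_nonneg z]
    have hz : ‖z‖ = 0 := by linarith [norm_nonneg x, norm_nonneg y, norm_nonneg z]
    have := h.sum_sq
    simp [hx, hy, hz] at this
  rcases mul_eq_zero.1 ((mul_eq_zero.1 h1).resolve_left h2) with h3 | h3
  · left; linarith
  rcases mul_eq_zero.1 h3 with h3 | h3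
  · right; left; linarith
  · right; right; linarith

/-- If no coordinate vanishes, the phases of the coordinates agree up to sixth roots of unity: the
cyclic condition makes three vectors with lengths `|x|, |y|, |z|` add up to zero, and the triangle
inequality is an equality. -/
theorem FiducialCoords.exists_phases {x y z : ℂ} (h : FiducialCoords x y z) (hx : x ≠ 0)
    (hy : y ≠ 0) (hz : z ≠ 0) (hd : ‖z‖ = ‖x‖ + ‖y‖) :
    ∃ (c : ℂ) (p q : Fin 3), ‖c‖ = 1 ∧ x = c * ‖x‖ ∧ y = c * (char3 p * ‖y‖) ∧
      z = c * (char3 q * -(‖x‖ + ‖y‖ : ℝ)) := by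
  have hnx : (‖x‖ : ℂ) ≠ 0 := by exact_mod_cast norm_ne_zero_iff.2 hx
  have hny : (‖y‖ : ℂ) ≠ 0 := by exact_mod_cast norm_ne_zero_iff.2 hy
  have hnz : (‖z‖ : ℂ) ≠ 0 := by exact_mod_cast norm_ne_zero_iff.2 hz
  have hsum : starRingEnd ℂ x ^ 2 / x + starRingEnd ℂ y ^ 2 / y + starRingEnd ℂ z ^ 2 / z = 0 := by
    field_simp
    linear_combination h.cyclic
  have hnorm : ∀ w : ℂ, w ≠ 0 → ‖starRingEnd ℂ w ^ 2 / w‖ = ‖w‖ := by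
    intro w hw
    have : ‖w‖ ≠ 0 := norm_ne_zero_iff.2 hw
    rw [norm_div, norm_pow, RCLike.norm_conj]
    field_simp
  have hray : SameRay ℝ (starRingEnd ℂ x ^ 2 / x) (starRingEnd ℂ y ^ 2 / y) := by
    rw [sameRay_iff_norm_add, hnorm x hx, hnorm y hy, ← hd, ← hnorm z hz, ← norm_neg]
    congr 1
    linear_combination -hsum
  have hxy := hray.norm_smul_eq
  rw [hnorm x hx, hnorm y hy, Complex.real_smul, Complex.real_smul] at hxy
  -- `hxy` and `hsum` compare the conjugates of the cubes of the phases of `x`, `y` and `z`.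
  have hcube : ∀ w : ℂ, w ≠ 0 → starRingEnd ℂ w ^ 2 / w * (w / ‖w‖) ^ 3 = ‖w‖ := by
    intro w hw
    have hw' : (‖w‖ : ℂ) ≠ 0 := by exact_mod_cast norm_ne_zero_iff.2 hw
    have := Complex.conj_mul' w
    field_simp
    linear_combination (starRingEnd ℂ w * w + (‖w‖ : ℂ) ^ 2) * this
  set u : ℂ := x / ‖x‖ with hu
  set v : ℂ := y / ‖y‖ with hv
  set w : ℂ := z / ‖z‖ with hw
  have hu0 : u ≠ 0 := div_ne_zero hx hnx
  have hv0 : v ≠ 0 := div_ne_zero hy hny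
  have hw0 : w ≠ 0 := div_ne_zero hz hnz
  have hX : starRingEnd ℂ x ^ 2 / x = ‖x‖ / u ^ 3 := by
    rw [eq_div_iff (pow_ne_zero 3 hu0)]
    exact hcube x hx
  have hY : starRingEnd ℂ y ^ 2 / y = ‖y‖ / v ^ 3 := by
    rw [eq_div_iff (pow_ne_zero 3 hv0)]
    exact hcube y hy
  have hZ : starRingEnd ℂ z ^ 2 / z = ‖z‖ / w ^ 3 := by
    rw [eq_div_iff (pow_ne_zero 3 hw0)]
    exact hcube z hz
  rw [hX, hY] at hxy
  have huv : v ^ 3 = u ^ 3 := by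
    field_simp at hxy
    exact hxy.symm
  rw [hX, hY, hZ, huv] at hsum
  have hdc : (‖z‖ : ℂ) = ‖x‖ + ‖y‖ := by exact_mod_cast hd
  have huw : w ^ 3 = -u ^ 3 := by
    have h1 : (‖z‖ : ℂ) * (w ^ 3 + u ^ 3) = 0 := by
      field_simp at hsum
      rw [hdc] at hsum ⊢
      linear_combination hsum
    linear_combination (mul_eq_zero.1 h1).resolve_left hnz
  obtain ⟨p, hp⟩ := exists_char3_eq_of_pow_three (z := v / u) (by
    rw [div_pow, huv, div_self (pow_ne_zero 3 hu0)])
  obtain ⟨q, hq⟩ := exists_char3_eq_of_pow_three (z := -w / u) (by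
    rw [div_pow, neg_pow, huw]
    field_simp)
  refine ⟨u, p, q, ?_, ?_, ?_, ?_⟩
  · rw [hu, norm_div, Complex.norm_real, norm_norm, div_self (norm_ne_zero_iff.2 hx)]
  · rw [hu]
    field_simp
  · rw [← hp, hv]
    field_simp
  · rw [← hq, hw]
    push_cast
    rw [← hdc]
    field_simp

/-- The Fourier transform maps the real kets whose coordinates add up to zero to kets unitarily
equivalent to some `fiducial3 t`. -/
theorem exists_unitarilyEquivalent_fiducial3_of_sum_eq_zero {a b : ℝ} {χ : Ket 3} (hn : ‖χ‖ = 1)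
    (h0 : χ 0 = a) (h1 : χ 1 = b) (h2 : χ 2 = -(a + b : ℝ)) :
    ∃ t : ℝ, UnitarilyEquivalent (hwOrbit χ) (hwOrbit (fiducial3 t)) := by
  have e0 : fourierIsometry χ 0 = 0 := by
    rw [fourierIsometry_apply, Fin.sum_univ_three]
    simp [h0, h1, h2]
  have e1 : fourierIsometry χ 1 = starRingEnd ℂ (fourierIsometry χ 2) := by
    rw [fourierIsometry_apply, fourierIsometry_apply, map_mul, Complex.conj_ofReal, map_sum]
    congr 1
    refine Finset.sum_congr rfl fun j _ => ?_
    have hr : starRingEnd ℂ (χ j) = χ j := by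
      fin_cases j
      · simp [h0]
      · simp [h1]
      · simp [h2]
    rw [map_mul, conj_char3, hr]
    exact congrArg (char3 · * χ j) ((by decide : ∀ j : Fin 3, 1 * j = -(2 * j)) j)
  have e1' : ‖fourierIsometry χ 1‖ = ‖fourierIsometry χ 2‖ := by rw [e1, RCLike.norm_conj]
  have hn' := EuclideanSpace.norm_sq_eq (fourierIsometry χ)
  rw [fourierIsometry.norm_map, hn, Fin.sum_univ_three, e0, e1', norm_zero] at hn'
  have e2 : ‖fourierIsometry χ 2‖ ^ 2 = 1 / 2 := by linarith
  obtain ⟨t, ht⟩ := exists_unitarilyEquivalent_fiducial3_of_zero e0 (by rw [e1', e2]) e2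
  exact ⟨t, (unitarilyEquivalent_hwOrbit_fourier χ).trans ht⟩

theorem exists_unitarilyEquivalent_fiducial3_of_degenerate {ψ : Ket 3}
    (h : FiducialCoords (ψ 0) (ψ 1) (ψ 2)) (hx : ψ 0 ≠ 0) (hy : ψ 1 ≠ 0) (hz : ψ 2 ≠ 0)
    (hd : ‖ψ 2‖ = ‖ψ 0‖ + ‖ψ 1‖) :
    ∃ t : ℝ, UnitarilyEquivalent (hwOrbit ψ) (hwOrbit (fiducial3 t)) := by
  obtain ⟨c, p, q, hc, e0, e1, e2⟩ := h.exists_phases hx hy hz hd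
  set χ : Ket 3 := WithLp.toLp 2 ![(‖ψ 0‖ : ℂ), (‖ψ 1‖ : ℂ), -((‖ψ 0‖ + ‖ψ 1‖ : ℝ) : ℂ)] with hχ
  -- Interpolation of the exponents `0, p, q` by a quadratic polynomial over `ℤ / 3`.
  set D := diagIsometry (fun i => char3 ((2 * p - q) * i * i + (q - p) * i))
    (fun _ => norm_char3 _) with hD
  have hψ : ψ = c • D χ := by
    ext i
    rw [PiLp.smul_apply, smul_eq_mul, hD, diagIsometry_apply]
    fin_cases i
    · simp only [Fin.zero_eta, mul_zero, add_zero, char3_zero, one_mul]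
      exact e0
    · rw [show (2 * p - q) * (⟨1, by norm_num⟩ : Fin 3) * ⟨1, by norm_num⟩
        + (q - p) * ⟨1, by norm_num⟩ = p from
        (by decide : ∀ p q : Fin 3, (2 * p - q) * 1 * 1 + (q - p) * 1 = p) p q]
      exact e1
    · rw [show (2 * p - q) * (⟨2, by norm_num⟩ : Fin 3) * ⟨2, by norm_num⟩
        + (q - p) * ⟨2, by norm_num⟩ = q from
        (by decide : ∀ p q : Fin 3, (2 * p - q) * 2 * 2 + (q - p) * 2 = q) p q]
      exact e2
  have hn : ‖χ‖ = 1 := by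
    have h1 : ‖ψ‖ = 1 := by
      rw [EuclideanSpace.norm_eq, Fin.sum_univ_three, h.sum_sq, Real.sqrt_one]
    rwa [hψ, norm_smul, hc, one_mul, D.norm_map] at h1
  obtain ⟨t, ht⟩ := exists_unitarilyEquivalent_fiducial3_of_sum_eq_zero hn (a := ‖ψ 0‖)
    (b := ‖ψ 1‖) rfl rfl rfl
  refine ⟨t, ?_⟩
  rw [hψ]
  exact (unitarilyEquivalent_hwOrbit_smul _ hc).trans
    ((unitarilyEquivalent_hwOrbit_diag _ _ χ).symm.trans ht)

theorem FiducialCoords.normSq_eq_half {x y z : ℂ} (h : FiducialCoords x y z) (hx : x = 0) :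
    ‖y‖ ^ 2 = 1 / 2 ∧ ‖z‖ ^ 2 = 1 / 2 := by
  have h1 := h.sum_sq
  have h2 := h.sum_mul
  simp only [hx, norm_zero] at h1 h2
  have h3 : (‖y‖ ^ 2 - 1 / 2) ^ 2 = 0 := by
    linear_combination ‖y‖ ^ 2 * h1 - h2
  have h4 := pow_eq_zero_iff (two_ne_zero) |>.1 h3
  constructor <;> linarith

/-- Every fiducial state generates a SIC POVM that is unitarily equivalent to the one generated
from some `fiducial3 t`. -/
theorem IsFiducial.exists_unitarilyEquivalent_fiducial3 {ψ : Ket 3} (h : IsFiducial ψ) :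
    ∃ t : ℝ, UnitarilyEquivalent (hwOrbit ψ) (hwOrbit (fiducial3 t)) := by
  have hrot : ∀ j : Fin 3,
      FiducialCoords (shiftKet j ψ 0) (shiftKet j ψ 1) (shiftKet j ψ 2) := by
    have h0 := h.fiducialCoords
    intro j
    fin_cases j
    · exact h0
    · exact h0.rotate
    · exact h0.rotate.rotate
  suffices ∃ (j : Fin 3) (t : ℝ),
      UnitarilyEquivalent (hwOrbit (shiftKet j ψ)) (hwOrbit (fiducial3 t)) by
    obtain ⟨j, t, ht⟩ := this
    exact ⟨t, (unitarilyEquivalent_hwOrbit_shiftKet j ψ).symm.trans ht⟩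
  by_cases hz : ∃ j, ψ j = 0
  · obtain ⟨j, hj⟩ := hz
    have h0 : shiftKet j ψ 0 = 0 := by simpa [shiftKet] using hj
    obtain ⟨h1, h2⟩ := (hrot j).normSq_eq_half h0
    exact ⟨j, exists_unitarilyEquivalent_fiducial3_of_zero h0 h1 h2⟩
  · push Not at hz
    have hz' : ∀ j i, shiftKet j ψ i ≠ 0 := fun j i => hz _
    rcases h.fiducialCoords.degenerate with hd | hd | hd
    · exact ⟨0, exists_unitarilyEquivalent_fiducial3_of_degenerate (hrot 0) (hz' _ _) (hz' _ _)
        (hz' _ _) hd⟩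
    · exact ⟨1, exists_unitarilyEquivalent_fiducial3_of_degenerate (hrot 1) (hz' _ _) (hz' _ _)
        (hz' _ _) hd⟩
    · exact ⟨2, exists_unitarilyEquivalent_fiducial3_of_degenerate (hrot 2) (hz' _ _) (hz' _ _)
        (hz' _ _) hd⟩

/-- The parameter of the representative can be reduced to the interval `[0, π / 9]`. -/
theorem IsFiducial.exists_mem_Icc {ψ : Ket 3} (h : IsFiducial ψ) :
    ∃ t ∈ Set.Icc 0 (Real.pi / 9), UnitarilyEquivalent (hwOrbit ψ) (hwOrbit (fiducial3 t)) := by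
  obtain ⟨t, ht⟩ := h.exists_unitarilyEquivalent_fiducial3
  refine ⟨Real.arccos (Real.cos (9 * t)) / 9, ⟨?_, ?_⟩, ht.trans
    (unitarilyEquivalent_fiducial3_of_cos_eq ?_)⟩
  · have := Real.arccos_nonneg (Real.cos (9 * t))
    positivity
  · have := Real.arccos_le_pi (Real.cos (9 * t))
    linarith
  · rw [mul_div_cancel₀ _ (by norm_num), Real.cos_arccos (Real.neg_one_le_cos _)
      (Real.cos_le_one _)]

theorem eq_of_cos_nine_mul_eq {s t : ℝ} (hs : s ∈ Set.Icc 0 (Real.pi / 9))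
    (ht : t ∈ Set.Icc 0 (Real.pi / 9)) (h : Real.cos (9 * s) = Real.cos (9 * t)) : s = t := by
  have := Real.injOn_cos (x₁ := 9 * s) (x₂ := 9 * t)
    ⟨by linarith [hs.1], by linarith [hs.2]⟩ ⟨by linarith [ht.1], by linarith [ht.2]⟩ h
  linarith

theorem Equivalent.permanent_gram_re_eq_fiducial3 {ψ : Ket 3} {t : ℝ}
    (h : Equivalent (hwOrbit ψ) (hwOrbit (fiducial3 t))) :
    (Matrix.gram ℂ (hwOrbit ψ)).permanent.re = 27 / 32 * (61 - Real.cos (9 * t)) := by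
  rw [h.permanent_gram_re_eq, permanent_gram_fiducial3, Complex.ofReal_re]

theorem IsFiducial.permanent_gram_re_nonneg {ψ : Ket 3} (h : IsFiducial ψ) :
    0 ≤ (Matrix.gram ℂ (hwOrbit ψ)).permanent.re := by
  obtain ⟨t, ht⟩ := h.exists_unitarilyEquivalent_fiducial3
  rw [ht.equivalent.permanent_gram_re_eq_fiducial3]
  linarith [sixty_one_sub_cos_pos (9 * t)]

end SICGM

end

theorem mainTheorem8 :
    (∀ t : ℝ,
      SICGM.IsFiducial (SICGM.fiducial3 t) ∧
      SICGM.IsSIC (SICGM.hwOrbit (SICGM.fiducial3 t)) ∧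
      (Matrix.gram ℂ (SICGM.hwOrbit (SICGM.fiducial3 t))).permanent =
        ((27 / 32 * (61 - Real.cos (9 * t)) : ℝ) : ℂ) ∧
      SICGM.geometricMeasure (SICGM.symState (SICGM.hwOrbit (SICGM.fiducial3 t))) =
        Real.logb 2 (16 * (61 - Real.cos (9 * t)) / 105)) ∧
    (∀ ψ : SICGM.Ket 3, SICGM.IsFiducial ψ →
      ∃! t : ℝ, t ∈ Set.Icc 0 (Real.pi / 9) ∧
        SICGM.Equivalent (SICGM.hwOrbit ψ) (SICGM.hwOrbit (SICGM.fiducial3 t))) ∧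
    (∀ ψ φ : SICGM.Ket 3, SICGM.IsFiducial ψ → SICGM.IsFiducial φ →
      (SICGM.Equivalent (SICGM.hwOrbit ψ) (SICGM.hwOrbit φ) ↔
        SICGM.geometricMeasure (SICGM.symState (SICGM.hwOrbit ψ)) =
          SICGM.geometricMeasure (SICGM.symState (SICGM.hwOrbit φ)))) := by
  refine ⟨fun t => ⟨SICGM.isFiducial_of_isSIC (SICGM.isSIC_fiducial3 t), SICGM.isSIC_fiducial3 t,
    SICGM.permanent_gram_fiducial3 t, SICGM.geometricMeasure_fiducial3 t⟩, fun ψ hψ => ?_,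
    fun ψ φ hψ hφ => ⟨fun h => ?_, fun h => ?_⟩⟩
  · obtain ⟨t, ht, hU⟩ := hψ.exists_mem_Icc
    refine ⟨t, ⟨ht, hU.equivalent⟩, fun s hs => SICGM.eq_of_cos_nine_mul_eq hs.1 ht ?_⟩
    linarith [hs.2.permanent_gram_re_eq_fiducial3, hU.equivalent.permanent_gram_re_eq_fiducial3]
  · exact h.geometricMeasure_symState_eq hψ.permanent_gram_re_nonneg
  · obtain ⟨s, -, hs⟩ := hψ.exists_mem_Icc
    obtain ⟨t, -, ht⟩ := hφ.exists_mem_Icc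
    rw [hs.equivalent.geometricMeasure_symState_eq hψ.permanent_gram_re_nonneg,
      ht.equivalent.geometricMeasure_symState_eq hφ.permanent_gram_re_nonneg,
      SICGM.geometricMeasure_fiducial3, SICGM.geometricMeasure_fiducial3] at h
    have hs0 := SICGM.sixty_one_sub_cos_pos (9 * s)
    have ht0 := SICGM.sixty_one_sub_cos_pos (9 * t)
    have hinj := Real.logb_injOn_pos (b := 2) (by norm_num)
      (Set.mem_Ioi.2 (by positivity)) (Set.mem_Ioi.2 (by positivity)) h
    exact (hs.trans ((SICGM.unitarilyEquivalent_fiducial3_of_cos_eq (by linarith)).trans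
      ht.symm)).equivalent
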